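/- **Setting.** Let $K\ge 1$ and $0<r_1<\dots<r_K$ be rates. In each slot $t=1,2,\dots$ one decision $k(t)\in\{1,\dots,K\}$ is taken, with reward $r_{k(t)}X_{k(t)}(t)$. Here $X_k(t)\in\{0,1\}$ has mean $\theta_k(t)\in[0,1]$, and the vector $(X_k(t))_{1\le k\le K}$ (its components may be dependent) is independent of everything that happened before slot $t$. Decisions are non-anticipating: $k(t)$ depends only on what happened before slot $t$. Suppose that for some $\sigma>0$, $|\theta_k(t')-\theta_k(t)|\le\sigma|t'-t|$ for all $k,t,t'$, and that at each time $t$ the throughputs are weakly unimodal: for some $m$, $r_1\theta_1(t)\le\dots\le r_m\theta_m(t)\ge r_{m+1}\theta_{m+1}(t)\ge\dots\ge r_K\theta_K(t)$. Let $k^\star(t)$ be a maximizer of $k\mapsto r_k\theta_k(t)$. The regret of a scheme $\pi$ is $$R^\pi(T)=\mathbb E\sum_{t=1}^T\big(r_{k^\star(t)}\theta_{k^\star(t)}(t)-r_{k(t)}\theta_{k(t)}(t)\big).$$ **Algorithm.** Let $I(p,q)=p\log\frac pq+(1-p)\log\frac{1-p}{1-q}$ be the Kullback–Leibler divergence of Bernoulli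 laws (values in $[0,+\infty]$, usual conventions). Let $\tau\ge 2$ be an integer (the window size) and $c>0$ a parameter with $\log\tau+c\log\log\tau\ge 0$ (automatic if $\tau\ge 3$). Let $t_k^\tau(n)$ be the number of slots $t\in\{n-\tau,\dots,n-1\}$, $t\ge 1$, with $k(t)=k$, and let $\hat\mu_k^\tau(n)$ be the average of $r_kX_k(t)$ over these slots ($0$ if there are none). Put $$q_k^\tau(n)=\max\Big\{q\in[0,r_k]:\ t_k^\tau(n)\,I\Big(\frac{\hat\mu_k^\tau(n)}{r_k},\frac q{r_k}\Big)\le\log\tau+c\log\log\tau\Big\}.$$ The algorithm SW-KL-R-UCB takes $k(n)=n$ for $n=1,\dots,K$, and for $n>K$ a decision $k(n)$ that maximizes $k\mapsto q_k^\tau(n)$, ties being broken arbitrarily. **Notation.** Let $$H(\Delta,T)=\sum_{n=1}^T\sum_{k=1}^K\sum_{k'\in N_n(k)}\mathbf 1\{|r_k\theta_k(n)-r_{k'}\theta_{k'}(n)|\le\Delta\},$$ where $N_n(k)=\{l\in\{k-1,k+1\}\cap\{1,\dots,K\}:\ r_k\theta_k(n)\le r_l\}$. With $x_k(n)=\frac{r_{k^\star(n)}}{r_k}\big(\theta_{k^\star(n)}(n)-\sigma\tau\big)$,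 let $$g_0=\tfrac12\min\big\{x_k(n)(1-x_k(n)):\ 1\le n\le T,\ k\ne k^\star(n),\ x_k(n)<1\big\},$$ with $g_0=+\infty$ and $g_0^{-1/2}=0$ if there is no such $(n,k)$. **Statement.** For every $c>0$ there is a constant $C>0$, depending only on $c$, such that in every setting as above, for all integers $T\ge\tau$ such that $g_0>0$ and all $\Delta>2r_K\tau\sigma$, the regret of $\pi=$ SW-KL-R-UCB satisfies $$\frac{R^\pi(T)}{T}\ \le\ \frac{\Delta\,H(\Delta,T)}{T}+K r_K^3\big(1+g_0^{-1/2}\big)\,\frac{\log\tau+c\log\log\tau+C}{2\tau(\Delta-2r_K\tau\sigma)^2}.$$ -/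

import Mathlib

open MeasureTheory ProbabilityTheory

namespace RateBandit

noncomputable section

/-- The Kullback-Leibler divergence `I(p, q) = p log (p / q) + (1 - p) log ((1 - p) / (1 - q))`
between the Bernoulli laws with parameters `p, q ∈ [0, 1]`, with the usual conventions
`0 log (0 / a) = 0` and `a log (a / 0) = +∞` for `a > 0`. -/
def bernoulliKL (p q : ℝ) : EReal :=
  if (q = 0 ∧ p ≠ 0) ∨ (q = 1 ∧ p ≠ 1) then ⊤
  else ((p * Real.log (p / q) + (1 - p) * Real.log ((1 - p) / (1 - q)) : ℝ) : EReal)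

/-- The slots `n - τ, …, n - 1` of the sliding window at time `n`; slots are numbered from `1`. -/
def window (τ n : ℕ) : Finset ℕ := Finset.Ico (max 1 (n - τ)) n

/-- `t_k^τ(n)`: how often decision `k` is taken in the window, when `sel t` is the decision
taken in slot `t`. -/
def pulls {K : ℕ} (τ : ℕ) (sel : ℕ → Fin K) (n : ℕ) (k : Fin K) : ℕ :=
  ((window τ n).filter fun t => sel t = k).card

/-- The empirical average reward of decision `k` over the window
(equal to `0` if `k` is not taken in the window). `X t k` tells whether a transmission at rate
`r k` in slot `t` is successful. -/
def empMean {K : ℕ} (r : Fin K → ℝ) (τ : ℕ) (X : ℕ → Fin K → Bool) (sel : ℕ → Fin K)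
    (n : ℕ) (k : Fin K) : ℝ :=
  (∑ t ∈ (window τ n).filter fun t => sel t = k, r k * (if X t k = true then 1 else 0)) /
    (pulls τ sel n k : ℝ)

/-- The exploration level `log τ + c log log τ`. -/
def level (τ : ℕ) (c : ℝ) : ℝ := Real.log τ + c * Real.log (Real.log τ)

/-- The index `q_k^τ(n)`: the largest `q ∈ [0, r_k]` such that
`t_k^τ(n) I(μ_k / r_k, q / r_k) ≤ log τ + c log log τ`, where `μ_k` is the empirical average. -/
def klIndex {K : ℕ} (r : Fin K → ℝ) (τ : ℕ) (c : ℝ) (X : ℕ → Fin K → Bool) (sel : ℕ → Fin K)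
    (n : ℕ) (k : Fin K) : ℝ :=
  sSup {q : ℝ | q ∈ Set.Icc 0 (r k) ∧
    ((pulls τ sel n k : ℝ) : EReal) * bernoulliKL (empMean r τ X sel n k / r k) (q / r k)
      ≤ (level τ c : EReal)}

/-- The sequence of decisions `sel 1, sel 2, …` is one that the algorithm SW-KL-R-UCB with window
size `τ` and parameter `c` takes on the outcomes `X`: first every decision once, in order, then
always a decision with maximal index (ties are broken arbitrarily). The decisions
`1, …, K` are the elements `0, …, K - 1` of `Fin K`. -/
def IsSWKLRUCB {K : ℕ} (r : Fin K → ℝ) (τ : ℕ) (c : ℝ) (X : ℕ → Fin K → Bool)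
    (sel : ℕ → Fin K) : Prop :=
  (∀ n : ℕ, 1 ≤ n → n ≤ K → (sel n : ℕ) + 1 = n) ∧
  (∀ n : ℕ, K < n → ∀ j : Fin K, klIndex r τ c X sel n j ≤ klIndex r τ c X sel n (sel n))

/-- The non-stationary environment: in slot `t ≥ 1` a transmission at rate `k` succeeds with
probability `θ t k`, and the outcomes of slot `t` (jointly over the rates, between which any
dependence is allowed) are independent of all that happened before, as recorded by `ℱ (t - 1)`. -/
structure IsEnvironment {Ω : Type*} [mΩ : MeasurableSpace Ω] (μ : Measure Ω)
    (ℱ : Filtration ℕ mΩ) {K : ℕ} (θ : ℕ → Fin K → ℝ) (X : ℕ → Fin K → Ω → Bool) : Prop where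
  adapted : ∀ t : ℕ, 1 ≤ t → ∀ k : Fin K, Measurable[ℱ t] (X t k)
  indep : ∀ t : ℕ, 1 ≤ t →
    Indep (MeasurableSpace.comap (fun ω => fun k : Fin K => X t k ω) inferInstance)
      (ℱ (t - 1)) μ
  prob_success : ∀ t : ℕ, 1 ≤ t → ∀ k : Fin K, μ.real {ω | X t k ω = true} = θ t k

/-- The throughputs `r_k η_k` are (weakly) unimodal in `k`: nondecreasing up to some index,
nonincreasing from there on. -/
def IsUnimodal {K : ℕ} (r η : Fin K → ℝ) : Prop :=
  ∃ m : Fin K, (∀ i j : Fin K, i ≤ j → j ≤ m → r i * η i ≤ r j * η j) ∧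
    (∀ i j : Fin K, m ≤ i → i ≤ j → r j * η j ≤ r i * η i)

/-- `N(k) = {l ∈ {k - 1, k + 1} : r_k η_k ≤ r_l}`. -/
def neighbors {K : ℕ} (r η : Fin K → ℝ) (k : Fin K) : Finset (Fin K) :=
  Finset.univ.filter fun l : Fin K =>
    ((l : ℕ) + 1 = (k : ℕ) ∨ (l : ℕ) = (k : ℕ) + 1) ∧ r k * η k ≤ r l

/-- `H(Δ, T)`: the number of triples of a slot `n ≤ T`, a decision `k` and a neighbor `k' ∈ N(k)`
(at time `n`) from which `k` is not separated by more than `Δ`. -/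
def nonSeparated {K : ℕ} (r : Fin K → ℝ) (θ : ℕ → Fin K → ℝ) (Δ : ℝ) (T : ℕ) : ℕ :=
  ∑ n ∈ Finset.Icc 1 T, ∑ k : Fin K,
    ((neighbors r (θ n) k).filter fun k' : Fin K =>
      |r k * θ n k - r k' * θ n k'| ≤ Δ).card

/-- The ratio `(r_{k⋆} / r_k) (θ_{k⋆}(n) - σ τ)` with `k⋆ = kstar n`. -/
def ratio {K : ℕ} (r : Fin K → ℝ) (θ : ℕ → Fin K → ℝ) (kstar : ℕ → Fin K) (σ : ℝ) (τ n : ℕ)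
    (k : Fin K) : ℝ :=
  r (kstar n) / r k * (θ n (kstar n) - σ * τ)

/-- `g₀`: half the minimum of `x (1 - x)`, `x` the above ratio, over the slots `1 ≤ n ≤ T` and the
decisions `k ≠ k⋆(n)` with `r_{k⋆(n)} (θ_{k⋆}(n) - σ τ) < r_k`; it is `+∞` if there are none. -/
def gZero {K : ℕ} (r : Fin K → ℝ) (θ : ℕ → Fin K → ℝ) (kstar : ℕ → Fin K) (σ : ℝ) (τ T : ℕ) :
    EReal :=
  ⨅ (n : ℕ) (_ : n ∈ Finset.Icc 1 T) (k : Fin K) (_ : k ≠ kstar n)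
    (_ : r (kstar n) * (θ n (kstar n) - σ * τ) < r k),
    ((1 / 2 * (ratio r θ kstar σ τ n k * (1 - ratio r θ kstar σ τ n k)) : ℝ) : EReal)

/-- `g ^ (-1/2)` for `0 < g ≤ +∞`. -/
def invSqrt (g : EReal) : ℝ := if g = ⊤ then 0 else g.toReal ^ (-(1 / 2) : ℝ)

/-- The regret up to time `T` of the decisions `sel` on one trajectory. -/
def pathRegret {K : ℕ} (r : Fin K → ℝ) (θ : ℕ → Fin K → ℝ) (kstar sel : ℕ → Fin K) (T : ℕ) : ℝ :=
  ∑ n ∈ Finset.Icc 1 T, (r (kstar n) * θ n (kstar n) - r (sel n) * θ n (sel n))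

/-- The (expected) regret `R^π(T)`. -/
def regret {Ω : Type*} [MeasurableSpace Ω] (μ : Measure Ω) {K : ℕ} (r : Fin K → ℝ)
    (θ : ℕ → Fin K → ℝ) (kstar : ℕ → Fin K) (sel : ℕ → Ω → Fin K) (T : ℕ) : ℝ :=
  ∫ ω, pathRegret r θ kstar (fun n => sel n ω) T ∂μ

end

end RateBandit

namespace RateBandit

/-! ### Inequalities for Bernoulli laws -/

/-! In a single slot, unimodality does the combinatorial work (`slot_regret_le`). If the regret is
positive but at most Δ, the chosen decision has a neighbor towards the optimum that is at least as
good and at most Δ better, so the slot contributes to H. It remains to bound the expected number of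
slots with regret above Δ, each costing at most R = r_K (`meanLE_card_large_regret`).

Write d = (Δ - 2Rτσ)/R, L = log τ + c log log τ and N = L/(2d²). Within a window the success
probabilities drift by at most στ. After the first K slots, a slot with regret above Δ is either one
where the index of the optimal decision falls below its drift-corrected mean by a small margin
e^{-80} d R, or a visit to a decision whose index exceeds its own drift-corrected mean by almost dR.
The first event has probability O(1/(τ d²)) (`measureReal_klIndex_lt_le`): in a union bound over the
number of samples, the margin makes the terms decay geometrically.

Visits are counted in blocks of τ slots, at most 2T/τ of them because T ≥ τ. A visit requires few
samples in the window, or an excess of successes that grows linearly with their number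
(`excess_ge_of_le_klIndex`, `excess_ge_of_rate_le`). Exponential supermartingales for sampled
outcomes then bound the expected number of visits in a block by uN + O(1/d²) (`meanLE_card_visits`).

The factor 2 from the blocks must be absorbed: 2u ≤ 1 + g₀^{-1/2}. If g₀ is finite, then g₀ ≤ 1/8,
and Pinsker's inequality gives u = 44/25, which is enough. If g₀ = +∞, the index of a visited
decision must almost reach its rate; the divergence from a smaller mean blows up there, and u = 1/3
is available. -/

lemma hoeffding_two_point {p : ℝ} (hp0 : 0 ≤ p) (hp1 : p ≤ 1) (l : ℝ) :
    p * Real.exp (l * (1 - p)) + (1 - p) * Real.exp (l * (0 - p)) ≤ Real.exp (l ^ 2 / 8) := by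
  let ν : Measure Bool :=
    ENNReal.ofReal p • Measure.dirac true + ENNReal.ofReal (1 - p) • Measure.dirac false
  have hν : IsProbabilityMeasure ν := ⟨by
    simp only [ν, Measure.coe_add, Measure.coe_smul, Pi.add_apply, Pi.smul_apply, measure_univ,
      smul_eq_mul, mul_one]
    rw [← ENNReal.ofReal_add hp0 (by linarith)]
    simp⟩
  have key : ∀ f : Bool → ℝ, ∫ b, f b ∂ν = p * f true + (1 - p) * f false := by
    intro f
    have := Measure.smul_finite (Measure.dirac true) (ENNReal.ofReal_ne_top (r := p))
    have := Measure.smul_finite (Measure.dirac false) (ENNReal.ofReal_ne_top (r := 1 - p))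
    simp only [ν]
    rw [integral_add_measure (.of_finite) (.of_finite), integral_smul_measure,
      integral_smul_measure, integral_dirac, integral_dirac]
    simp [ENNReal.toReal_ofReal, hp0, hp1]
  have h := (hasSubgaussianMGF_of_mem_Icc (μ := ν) (X := fun b : Bool => if b then (1 : ℝ) else 0)
    (a := 0) (b := 1) (measurable_of_finite _).aemeasurable
    (Filter.Eventually.of_forall fun b => by cases b <;> simp)).mgf_le l
  rw [mgf, key, key] at h
  simp only [if_true, Bool.false_eq_true, if_false, mul_one, mul_zero, add_zero] at h
  refine h.trans (le_of_eq ?_)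
  congr 1
  simp
  ring

/-- The real-valued expression of the divergence between Bernoulli laws. -/
noncomputable def klReal (p q : ℝ) : ℝ :=
  p * Real.log (p / q) + (1 - p) * Real.log ((1 - p) / (1 - q))

lemma sub_le_mul_log_div {p x : ℝ} (hp : 0 ≤ p) (hx : 0 < x) : p - x ≤ p * Real.log (p / x) := by
  rcases hp.eq_or_lt with rfl | hp
  · simp [hx.le]
  · have h := Real.log_le_sub_one_of_pos (div_pos hx hp)
    rw [← inv_div, Real.log_inv] at h
    have h2 := mul_le_mul_of_nonneg_left h hp.le
    have h3 : p * ((p / x)⁻¹ - 1) = x - p := by field_simp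
    linarith

lemma mul_log_div_split {p x q : ℝ} (hx : 0 < x) (hq : 0 < q) :
    p * Real.log (p / q) = p * Real.log (p / x) + p * Real.log (x / q) := by
  rcases eq_or_ne p 0 with rfl | hp
  · simp
  · rw [Real.log_div hp hq.ne', Real.log_div hp hx.ne', Real.log_div hx.ne' hq.ne']
    ring

/-- Pinsker's inequality by duality: the law `p` is compared with `q` tilted by `l`, whose
normalization `M` is controlled by Hoeffding's lemma. The choice l = 4(p - q) maximizes l(p - q) -
l²/8. -/
lemma two_mul_sq_le_klReal {p q : ℝ} (hp0 : 0 ≤ p) (hp1 : p ≤ 1) (hq0 : 0 < q) (hq1 : q < 1) :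
    2 * (q - p) ^ 2 ≤ klReal p q := by
  set l : ℝ := 4 * (p - q) with hl
  set M : ℝ := q * Real.exp l + (1 - q) with hM
  have hq1' : 0 < 1 - q := by linarith
  have hqe : 0 < q * Real.exp l := mul_pos hq0 (Real.exp_pos l)
  have hMpos : 0 < M := by positivity
  have hlogM : Real.log M ≤ l * q + l ^ 2 / 8 := by
    have h := hoeffding_two_point hq0.le hq1.le l
    have : q * Real.exp (l * (1 - q)) + (1 - q) * Real.exp (l * (0 - q))
        = M * Real.exp (-(l * q)) := by
      rw [show l * (1 - q) = l + -(l * q) by ring, show l * (0 - q) = -(l * q) by ring,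
        Real.exp_add, hM]
      ring
    rw [this] at h
    rw [Real.log_le_iff_le_exp hMpos, Real.exp_add]
    rw [Real.exp_neg, ← div_eq_mul_inv, div_le_iff₀ (Real.exp_pos _)] at h
    linarith
  have h1 := sub_le_mul_log_div hp0 (div_pos hqe hMpos)
  have h2 := sub_le_mul_log_div (p := 1 - p) (by linarith) (div_pos hq1' hMpos)
  have e1 := mul_log_div_split (p := p) (div_pos hqe hMpos) hq0
  have e2 := mul_log_div_split (p := 1 - p) (div_pos hq1' hMpos) hq1'
  have f1 : Real.log (q * Real.exp l / M / q) = l - Real.log M := by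
    rw [show q * Real.exp l / M / q = Real.exp l / M by field_simp,
      Real.log_div (Real.exp_pos l).ne' hMpos.ne', Real.log_exp]
  have f2 : Real.log ((1 - q) / M / (1 - q)) = - Real.log M := by
    rw [show (1 - q) / M / (1 - q) = M⁻¹ by field_simp, Real.log_inv]
  rw [f1] at e1
  rw [f2] at e2
  have f3 : q * Real.exp l / M + (1 - q) / M = 1 := by
    rw [← add_div, div_self hMpos.ne']
  rw [klReal, e1, e2]
  have : l * p - (l * q + l ^ 2 / 8) = 2 * (q - p) ^ 2 := by rw [hl]; ring
  nlinarith

/-- The difference of the divergences is x log(q/p) + (1 - x) log((1 - q)/(1 - p)), nonincreasing in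
x. At x = q it equals the divergence of q from p, to which Pinsker applies. -/
lemma klReal_add_two_mul_sq_le {x q p : ℝ} (hxq : x ≤ q) (hq0 : 0 < q)
    (hqp : q ≤ p) (hp1 : p < 1) : klReal x q + 2 * (p - q) ^ 2 ≤ klReal x p := by
  have hp0 : 0 < p := by linarith
  have h := two_mul_sq_le_klReal hq0.le (by linarith) hp0 hp1
  have e1 := mul_log_div_split (p := x) hq0 hp0
  have e2 := mul_log_div_split (p := 1 - x) (x := 1 - q) (q := 1 - p) (by linarith) (by linarith)
  have l1 : Real.log (q / p) ≤ 0 :=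
    Real.log_nonpos (by positivity) ((div_le_one hp0).2 hqp)
  have l2 : 0 ≤ Real.log ((1 - q) / (1 - p)) :=
    Real.log_nonneg ((one_le_div (by linarith)).2 (by linarith))
  unfold klReal at *
  rw [e1, e2]
  nlinarith

/-- Much sharper than Pinsker when y is close to 1; the success term is at least x - y ≥ -(1 - x).
-/
lemma mul_log_sub_one_le_klReal {x y : ℝ} (hx0 : 0 ≤ x) (hy0 : 0 < y)
    (hy1 : y < 1) : (1 - x) * (Real.log ((1 - x) / (1 - y)) - 1) ≤ klReal x y := by
  have h := sub_le_mul_log_div hx0 hy0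
  unfold klReal
  nlinarith

lemma bernoulliKL_eq_coe {p q : ℝ} (hq0 : 0 < q) (hq1 : q < 1) :
    bernoulliKL p q = (klReal p q : EReal) := by
  rw [bernoulliKL, if_neg (by rintro (⟨h, -⟩ | ⟨h, -⟩) <;> linarith), klReal]

lemma two_mul_sq_le_bernoulliKL {p q : ℝ} (hp0 : 0 ≤ p) (hp1 : p ≤ 1) (hq0 : 0 ≤ q)
    (hq1 : q ≤ 1) : ((2 * (q - p) ^ 2 : ℝ) : EReal) ≤ bernoulliKL p q := by
  rcases hq0.eq_or_lt with rfl | hq0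
  · by_cases hp : p = 0
    · simp [bernoulliKL, hp]
    · simp [bernoulliKL, hp]
  rcases hq1.eq_or_lt with rfl | hq1
  · by_cases hp : p = 1
    · simp [bernoulliKL, hp]
    · simp [bernoulliKL, hp]
  rw [bernoulliKL_eq_coe hq0 hq1]
  exact_mod_cast two_mul_sq_le_klReal hp0 hp1 hq0 hq1

lemma bernoulliKL_self {p : ℝ} : bernoulliKL p p = 0 := by
  rw [bernoulliKL, if_neg (by tauto)]
  by_cases h0 : p = 0
  · simp [h0]
  by_cases h1 : p = 1
  · simp [h1]
  rw [div_self h0, div_self (sub_ne_zero.2 (Ne.symm h1))]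
  simp

/-! ### Exponential bounds for sampled outcomes -/

section Probability

open Classical in
-- Multiplying, over the slots selected by predictable events, factors of mean at most 1 gives a
-- nonnegative supermartingale; Markov's inequality concludes. Both concentration bounds below are
-- instances, with different `G` and `f`.
lemma measureReal_le_exp_neg {Ω : Type*} {mΩ : MeasurableSpace Ω} {μ : Measure Ω}
    [IsProbabilityMeasure μ] {ℱ : Filtration ℕ mΩ} {K : ℕ} {θ : ℕ → Fin K → ℝ}
    {X : ℕ → Fin K → Ω → Bool} (hX : IsEnvironment μ ℱ θ X) (k : Fin K) {a b : ℕ} (ha : 1 ≤ a)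
    (hab : a ≤ b) (G : ℕ → Set Ω)
    (hG : ∀ t, a ≤ t → MeasurableSet[ℱ (t - 1)] (G t)) (f : ℕ → Bool → ℝ)
    (hf0 : ∀ t b, 0 ≤ f t b)
    (hf : ∀ t, a ≤ t → t < b → θ t k * f t true + (1 - θ t k) * f t false ≤ 1) (x : ℝ) (A : Set Ω)
    (hA : ∀ ω ∈ A, Real.exp x ≤ ∏ t ∈ Finset.Ico a b, if ω ∈ G t then f t (X t k ω) else 1) :
    μ.real A ≤ Real.exp (-x) := by
  set g : ℕ → Bool → ENNReal := fun t c => ENNReal.ofReal (f t c) with hg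
  set Z : ℕ → Ω → ENNReal := fun n ω =>
    ∏ t ∈ Finset.Ico a n, if ω ∈ G t then g t (X t k ω) else 1 with hZ
  have hXm : ∀ t, 1 ≤ t → Measurable (X t k) := fun t ht =>
    (hX.adapted t ht k).mono (ℱ.le t) le_rfl
  have hZm : ∀ n, Measurable[ℱ (n - 1)] (Z n) := by
    intro n
    refine Finset.measurable_prod _ fun t ht => ?_
    rw [Finset.mem_Ico] at ht
    refine Measurable.ite (ℱ.mono (by omega) _ (hG t ht.1)) ?_ measurable_const
    exact (measurable_of_finite (g t)).comp
      ((hX.adapted t (by omega) k).mono (ℱ.mono (by omega)) le_rfl)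
  have hone : ∀ t, a ≤ t → t < b → ∫⁻ ω, g t (X t k ω) ∂μ ≤ 1 := by
    intro t hat htb
    have hm := hXm t (by omega)
    have hp := hX.prob_success t (by omega) k
    have hθ0 : 0 ≤ θ t k := hp ▸ measureReal_nonneg
    have hθ1 : θ t k ≤ 1 := hp ▸ measureReal_le_one
    rw [← lintegral_map (measurable_of_finite (g t)) hm, lintegral_fintype]
    rw [Fintype.sum_bool, Measure.map_apply hm (measurableSet_singleton _),
      Measure.map_apply hm (measurableSet_singleton _)]
    have h1 : μ (X t k ⁻¹' {true}) = ENNReal.ofReal (θ t k) := by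
      rw [← hp, measureReal_def, ENNReal.ofReal_toReal (measure_ne_top _ _)]
      rfl
    have h2 : μ (X t k ⁻¹' {false}) = ENNReal.ofReal (1 - θ t k) := by
      have : X t k ⁻¹' {false} = (X t k ⁻¹' {true})ᶜ := by
        ext ω; simp
      rw [this, prob_compl_eq_one_sub (hm (measurableSet_singleton _)), h1,
        ENNReal.ofReal_sub _ hθ0, ENNReal.ofReal_one]
    rw [h1, h2, hg, ← ENNReal.ofReal_mul (hf0 _ _), ← ENNReal.ofReal_mul (hf0 _ _),
      ← ENNReal.ofReal_add (mul_nonneg (hf0 _ _) hθ0) (mul_nonneg (hf0 _ _) (by linarith))]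
    refine ENNReal.ofReal_le_one.2 ?_
    linarith [hf t hat htb]
  have hint : ∀ n, a ≤ n → n ≤ b → ∫⁻ ω, Z n ω ∂μ ≤ 1 := by
    intro n hn
    induction n, hn using Nat.le_induction with
    | base => intro _; simp [hZ]
    | succ n hn ih =>
      intro hnb
      refine le_trans ?_ (ih (by omega))
      have hGm := hG n hn
      -- On `G n` the new factor is independent of the past, which contains both `G n` and `Z n`;
      -- off `G n` the product does not change.
      have hsplit : ∀ ω, Z (n + 1) ω =
          (G n).indicator (Z n) ω * g n (X n k ω) + (G n)ᶜ.indicator (Z n) ω := by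
        intro ω
        simp only [hZ]
        rw [Finset.prod_Ico_succ_top hn]
        by_cases h : ω ∈ G n <;> simp [h]
      have hm1 : Measurable[ℱ (n - 1)] ((G n).indicator (Z n)) := (hZm n).indicator hGm
      have hm2 : Measurable ((G n)ᶜ.indicator (Z n)) :=
        ((hZm n).indicator hGm.compl).mono (ℱ.le _) le_rfl
      have hvec : Measurable (fun ω => fun k : Fin K => X n k ω) :=
        measurable_pi_lambda _ fun j => (hX.adapted n (by omega) j).mono (ℱ.le n) le_rfl
      have hgX : Measurable[MeasurableSpace.comap (fun ω => fun k : Fin K => X n k ω) inferInstance]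
          (fun ω => g n (X n k ω)) :=
        ((measurable_of_finite fun v : Fin K → Bool => g n (v k)).comp
          (comap_measurable fun ω => fun k : Fin K => X n k ω) :)
      simp_rw [hsplit]
      rw [lintegral_add_right _ hm2,
        lintegral_mul_eq_lintegral_mul_lintegral_of_independent_measurableSpace (ℱ.le (n - 1))
          hvec.comap_le (hX.indep n (by omega)).symm hm1 hgX]
      calc _ ≤ (∫⁻ ω, (G n).indicator (Z n) ω ∂μ) * 1
            + ∫⁻ ω, (G n)ᶜ.indicator (Z n) ω ∂μ := by
            gcongr
            exact hone n hn (by omega)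
        _ = ∫⁻ ω, Z n ω ∂μ := by
            rw [mul_one, ← lintegral_add_right _ hm2]
            refine lintegral_congr fun ω => ?_
            exact Set.indicator_self_add_compl_apply (G n) (Z n) ω
  have hsub : A ⊆ {ω | ENNReal.ofReal (Real.exp x) ≤ Z b ω} := by
    intro ω hω
    have h := ENNReal.ofReal_le_ofReal (hA ω hω)
    rw [ENNReal.ofReal_prod_of_nonneg (fun t _ => by split_ifs; exacts [hf0 _ _, zero_le_one])] at h
    refine h.trans (le_of_eq (Finset.prod_congr rfl fun t _ => ?_))
    split_ifs <;> simp [hg]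
  have hmark := mul_meas_ge_le_lintegral (μ := μ) ((hZm b).mono (ℱ.le _) le_rfl)
    (ENNReal.ofReal (Real.exp x))
  have h1 : ENNReal.ofReal (Real.exp x) * μ A ≤ 1 :=
    (mul_le_mul_right (measure_mono hsub) _).trans (hmark.trans (hint b hab le_rfl))
  have h2 := ENNReal.toReal_mono ENNReal.one_ne_top h1
  rw [ENNReal.toReal_mul, ENNReal.toReal_ofReal (Real.exp_pos x).le, ENNReal.toReal_one] at h2
  rw [Real.exp_neg, measureReal_def, ← one_div, le_div_iff₀ (Real.exp_pos x)]
  linarith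

/-- The slots in `[a, b)` in which decision `k` is taken. -/
def pullSlots {K : ℕ} (sel : ℕ → Fin K) (k : Fin K) (a b : ℕ) : Finset ℕ :=
  (Finset.Ico a b).filter fun t => sel t = k

/-- The number of successes of decision `k` in `[a, b)`. -/
def successes {K : ℕ} (x : ℕ → Fin K → Bool) (sel : ℕ → Fin K) (k : Fin K) (a b : ℕ) : ℕ :=
  ((pullSlots sel k a b).filter fun t => x t k = true).card

/-- The sum over the slots in `[a, b)` in which `k` is taken of the success indicator minus the
success probability. -/
noncomputable def excess {K : ℕ} (θ : ℕ → Fin K → ℝ) (x : ℕ → Fin K → Bool) (sel : ℕ → Fin K)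
    (k : Fin K) (a b : ℕ) : ℝ :=
  ∑ t ∈ pullSlots sel k a b, ((if x t k = true then 1 else 0) - θ t k)

lemma excess_eq_sum_ite {K : ℕ} (θ : ℕ → Fin K → ℝ) (x : ℕ → Fin K → Bool) (sel : ℕ → Fin K)
    (k : Fin K) (a b : ℕ) : excess θ x sel k a b = ∑ t ∈ Finset.Ico a b,
      if sel t = k then ((if x t k = true then 1 else 0) - θ t k) else 0 := by
  rw [excess, pullSlots, Finset.sum_filter]

lemma card_pullSlots_eq_sum_ite {K : ℕ} (sel : ℕ → Fin K)
    (k : Fin K) (a b : ℕ) : ((pullSlots sel k a b).card : ℝ) = ∑ t ∈ Finset.Ico a b,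
      if sel t = k then (1 : ℝ) else 0 := by
  rw [pullSlots, Finset.sum_boole]

variable {Ω : Type*} {mΩ : MeasurableSpace Ω} {μ : Measure Ω}
    [IsProbabilityMeasure μ] {ℱ : Filtration ℕ mΩ} {K : ℕ} {θ : ℕ → Fin K → ℝ}
    {X : ℕ → Fin K → Ω → Bool} {sel : ℕ → Ω → Fin K}

open Classical in
/-- A maximal Azuma-Hoeffding inequality for the excess of successes of a decision. -/
lemma measureReal_exists_excess_le (hX : IsEnvironment μ ℱ θ X)
    (hsel : ∀ n, 1 ≤ n → Measurable[ℱ (n - 1)] (sel n)) (k : Fin K) {a b : ℕ} (ha : 1 ≤ a)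
    (hab : a ≤ b) (l x : ℝ) :
    μ.real {ω | ∃ u, a ≤ u ∧ u ≤ b ∧
      x ≤ l * excess θ (fun t k => X t k ω) (fun t => sel t ω) k a u
        - l ^ 2 / 8 * ((pullSlots (fun t => sel t ω) k a u).card : ℝ)} ≤ Real.exp (-x) := by
  set V : ℕ → Ω → ℝ := fun u ω => l * excess θ (fun t k => X t k ω) (fun t => sel t ω) k a u
        - l ^ 2 / 8 * ((pullSlots (fun t => sel t ω) k a u).card : ℝ) with hV
  have hVsum : ∀ u ω, V u ω = ∑ t ∈ Finset.Ico a u, if sel t ω = k then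
      l * ((if X t k ω = true then 1 else 0) - θ t k) - l ^ 2 / 8 else 0 := by
    intro u ω
    simp only [hV]
    rw [excess_eq_sum_ite, card_pullSlots_eq_sum_ite, Finset.mul_sum, Finset.mul_sum,
      ← Finset.sum_sub_distrib]
    refine Finset.sum_congr rfl fun t _ => ?_
    split_ifs <;> ring
  have hVm : ∀ u, Measurable[ℱ (u - 1)] (V u) := by
    intro u
    rw [show V u = fun ω => _ from funext (hVsum u)]
    refine Finset.measurable_sum _ fun t ht => ?_
    rw [Finset.mem_Ico] at ht
    refine Measurable.ite (ℱ.mono (by omega) _ (hsel t (by omega) (measurableSet_singleton k)))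
      ?_ measurable_const
    exact (measurable_of_finite
      (fun c : Bool => l * ((if c = true then 1 else 0) - θ t k) - l ^ 2 / 8)).comp
      ((hX.adapted t (by omega) k).mono (ℱ.mono (by omega)) le_rfl)
  refine measureReal_le_exp_neg hX k ha hab
    -- Sampling stops once the level `x` has been reached, so the product up to `b` keeps its value
    -- from the first crossing. This turns a bound at a fixed time into a maximal one.
    (fun t => {ω | sel t ω = k} ∩ ⋂ u ∈ Finset.Icc a t, {ω | V u ω < x}) ?_
    (fun t c => Real.exp (l * ((if c = true then 1 else 0) - θ t k) - l ^ 2 / 8))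
    (fun _ _ => (Real.exp_pos _).le) ?_ x _ ?_
  · intro t ht
    refine MeasurableSet.inter (hsel t (by omega) (measurableSet_singleton k)) ?_
    refine Finset.measurableSet_biInter _ fun u hu => ?_
    rw [Finset.mem_Icc] at hu
    exact ((hVm u).mono (ℱ.mono (by omega)) le_rfl) measurableSet_Iio
  · intro t ht htb
    have hp := hX.prob_success t (by omega) k
    have hθ0 : 0 ≤ θ t k := hp ▸ measureReal_nonneg
    have hθ1 : θ t k ≤ 1 := hp ▸ measureReal_le_one
    have h := hoeffding_two_point hθ0 hθ1 l
    simp only [if_true, Bool.false_eq_true, if_false, Real.exp_sub]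
    rw [← mul_div_assoc, ← mul_div_assoc, ← add_div, div_le_one (Real.exp_pos _)]
    exact h
  · intro ω hω
    have hex : ∃ u, a ≤ u ∧ u ≤ b ∧ x ≤ V u ω := hω
    set u := Nat.find hex with hu
    obtain ⟨hau, hub, hxu⟩ := Nat.find_spec hex
    have hmin : ∀ v, a ≤ v → v < u → V v ω < x := by
      intro v hav hvu
      by_contra! h
      exact Nat.find_min hex hvu ⟨hav, by omega, h⟩
    rw [← Finset.prod_Ico_consecutive _ hau hub]
    rw [Finset.prod_congr rfl (s₁ := Finset.Ico u b) (g := fun _ => (1 : ℝ)), Finset.prod_const_one,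
      mul_one]
    · rw [Finset.prod_congr rfl (s₁ := Finset.Ico a u) (g := fun t => Real.exp
        (if sel t ω = k then
          l * ((if X t k ω = true then 1 else 0) - θ t k) - l ^ 2 / 8 else 0)),
        ← Real.exp_sum, ← hVsum]
      · exact Real.exp_le_exp.2 hxu
      · intro t ht
        rw [Finset.mem_Ico] at ht
        have : (ω ∈ {ω | sel t ω = k} ∩ ⋂ u ∈ Finset.Icc a t, {ω | V u ω < x}) ↔ sel t ω = k := by
          simp only [Set.mem_inter_iff, Set.mem_ofPred_eq, Set.mem_iInter, Finset.mem_Icc,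
            and_iff_left_iff_imp]
          intro _ v hv
          exact hmin v hv.1 (by omega)
        simp only [this]
        split_ifs <;> simp
    · intro t ht
      rw [Finset.mem_Ico] at ht
      rw [if_neg]
      intro h
      have := Set.mem_iInter₂.1 h.2 u (Finset.mem_Icc.2 ⟨hau, ht.1⟩)
      exact absurd hxu (not_le.2 this)

/-- The Chernoff bound for the number of successes of a decision that is taken `s` times. -/
lemma measureReal_successes_le (hX : IsEnvironment μ ℱ θ X)
    (hsel : ∀ n, 1 ≤ n → Measurable[ℱ (n - 1)] (sel n)) (k : Fin K) {a b : ℕ} (ha : 1 ≤ a)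
    (hab : a ≤ b) {p : ℝ} (hp0 : 0 < p) (hp1 : p < 1) (hpθ : ∀ t, a ≤ t → t < b → p ≤ θ t k)
    {s m : ℕ} (hs : 1 ≤ s) (hmp : (m : ℝ) / s ≤ p) :
    μ.real {ω | (pullSlots (fun t => sel t ω) k a b).card = s ∧
      successes (fun t k => X t k ω) (fun t => sel t ω) k a b ≤ m} ≤
      Real.exp (-(s * klReal (m / s) p)) := by
  classical
  have hs0 : (0 : ℝ) < s := by exact_mod_cast hs
  set y : ℝ := (m : ℝ) / s with hy
  have hy0 : 0 ≤ y := by positivity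
  have hy1 : y < 1 := by linarith
  -- `A` and `B` are the likelihood ratios of Bernoulli(y) to Bernoulli(p). As A ≤ 1 ≤ B, their mean
  -- under any success probability ≥ p is at most 1, and fewer successes only increase the product.
  set A := y / p with hA
  set B := (1 - y) / (1 - p) with hB
  have hA0 : 0 ≤ A := by positivity
  have hA1 : A ≤ 1 := (div_le_one hp0).2 hmp
  have hB1 : 1 ≤ B := (one_le_div (by linarith)).2 (by linarith)
  have hms : m ≤ s := by
    have : (m : ℝ) ≤ s := by
      rw [hy, div_lt_one hs0] at hy1; exact hy1.le
    exact_mod_cast this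
  refine measureReal_le_exp_neg hX k ha hab (fun t => {ω | sel t ω = k})
    (fun t ht => hsel t (by omega) (measurableSet_singleton k))
    (fun t c => if c = true then A else B) (fun t c => by split_ifs <;> linarith) ?_ _ _ ?_
  · intro t hat htb
    simp only [if_true, Bool.false_eq_true, if_false]
    have h := hpθ t hat htb
    have e : p * A + (1 - p) * B = 1 := by
      rw [hA, hB, mul_div_cancel₀ _ hp0.ne', mul_div_cancel₀ _ (by linarith)]; ring
    nlinarith
  · rintro ω ⟨hcard, hsucc⟩
    set x : ℕ → Fin K → Bool := fun t k => X t k ω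
    have e1 : (∏ t ∈ Finset.Ico a b, if ω ∈ {ω | sel t ω = k} then
        (if X t k ω = true then A else B) else 1) =
        A ^ successes x (fun t => sel t ω) k a b *
          B ^ (s - successes x (fun t => sel t ω) k a b) := by
      simp only [Set.mem_ofPred_eq]
      rw [← Finset.prod_filter, Finset.prod_ite, Finset.prod_const, Finset.prod_const]
      congr 2
      have := Finset.card_filter_add_card_filter_not (s := pullSlots (fun t => sel t ω) k a b)
        (fun t => x t k = true)
      rw [hcard] at this
      change (Finset.filter (fun t => ¬ x t k = true) (pullSlots (fun t => sel t ω) k a b)).card = _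
      rw [successes]
      omega
    refine le_of_le_of_eq ?_ (e1.symm.trans (Finset.prod_congr rfl fun t _ => by congr))
    have e2 : Real.exp (s * klReal y p) = A ^ m * B ^ (s - m) := by
      have hsy : (s : ℝ) * y = m := by rw [hy]; field_simp
      have hB0 : 0 < B := by linarith
      have hBB : Real.exp (((s - m : ℕ) : ℝ) * Real.log B) = B ^ (s - m) := by
        rw [← Real.log_pow, Real.exp_log (by positivity)]
      have hAA : Real.exp ((m : ℝ) * Real.log A) = A ^ m := by
        rcases Nat.eq_zero_or_pos m with h | h
        · simp [h]
        · have : 0 < A := by positivity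
          rw [← Real.log_pow, Real.exp_log (by positivity)]
      rw [← hAA, ← hBB, ← Real.exp_add, klReal, Nat.cast_sub hms]
      congr 1
      linear_combination (Real.log A - Real.log B) * hsy
    rw [e2]
    exact mul_le_mul (pow_le_pow_of_le_one hA0 hA1 hsucc) (pow_le_pow_right₀ hB1 (by omega))
      (by positivity) (by positivity)

end Probability

/-! ### Domination in mean -/

/-- `f` (not necessarily measurable) is dominated by an integrable function of mean at most `c`. -/
def MeanLE {Ω : Type*} {mΩ : MeasurableSpace Ω} (μ : Measure Ω) (f : Ω → ℝ) (c : ℝ) : Prop :=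
  ∃ g : Ω → ℝ, Integrable g μ ∧ (∀ ω, f ω ≤ g ω) ∧ ∫ ω, g ω ∂μ ≤ c

namespace MeanLE

variable {Ω : Type*} {mΩ : MeasurableSpace Ω} {μ : Measure Ω} {f f' : Ω → ℝ} {c c' : ℝ}

lemma mono (h : MeanLE μ f c) (hf : ∀ ω, f' ω ≤ f ω) (hc : c ≤ c') : MeanLE μ f' c' := by
  obtain ⟨g, hg, hfg, hgc⟩ := h
  exact ⟨g, hg, fun ω => (hf ω).trans (hfg ω), hgc.trans hc⟩

lemma add (h : MeanLE μ f c) (h' : MeanLE μ f' c') : MeanLE μ (fun ω => f ω + f' ω) (c + c') := by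
  obtain ⟨g, hg, hfg, hgc⟩ := h
  obtain ⟨g', hg', hfg', hgc'⟩ := h'
  refine ⟨fun ω => g ω + g' ω, hg.add hg', fun ω => add_le_add (hfg ω) (hfg' ω), ?_⟩
  rw [integral_add hg hg']
  linarith

lemma const_mul (h : MeanLE μ f c) {a : ℝ} (ha : 0 ≤ a) :
    MeanLE μ (fun ω => a * f ω) (a * c) := by
  obtain ⟨g, hg, hfg, hgc⟩ := h
  refine ⟨fun ω => a * g ω, hg.const_mul a, fun ω => mul_le_mul_of_nonneg_left (hfg ω) ha, ?_⟩
  rw [integral_const_mul]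
  exact mul_le_mul_of_nonneg_left hgc ha

lemma const [IsProbabilityMeasure μ] (c : ℝ) : MeanLE μ (fun _ => c) c :=
  ⟨fun _ => c, integrable_const c, fun _ => le_rfl, by simp⟩

lemma sum {ι : Type*} (s : Finset ι) {f : ι → Ω → ℝ} {c : ι → ℝ}
    (h : ∀ i ∈ s, MeanLE μ (f i) (c i)) : MeanLE μ (fun ω => ∑ i ∈ s, f i ω) (∑ i ∈ s, c i) := by
  classical
  induction s using Finset.induction_on with
  | empty => exact ⟨fun _ => 0, integrable_zero _ _ _, fun _ => by simp, by simp⟩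
  | insert i s hi ih =>
    simp only [Finset.sum_insert hi]
    exact (h i (Finset.mem_insert_self _ _)).add
      (ih fun j hj => h j (Finset.mem_insert_of_mem hj))

open Classical in
-- The measurable hull dominates `A` at no cost in probability, so the measurability of events
-- defined through the indices never has to be checked.
lemma of_measureReal_le [IsProbabilityMeasure μ] {A : Set Ω} (hA : μ.real A ≤ c) :
    MeanLE μ (fun ω => if ω ∈ A then 1 else 0) c := by
  refine ⟨(toMeasurable μ A).indicator 1,
    (integrable_const (1 : ℝ)).indicator (measurableSet_toMeasurable μ A), fun ω => ?_, ?_⟩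
  · by_cases h : ω ∈ A
    · simp [h, subset_toMeasurable μ A h]
    · simp only [h, if_false]
      exact Set.indicator_nonneg (fun _ _ => zero_le_one) _
  · rw [integral_indicator_one (measurableSet_toMeasurable μ A), measureReal_def,
      measure_toMeasurable]
    exact hA

lemma integral_le (h : MeanLE μ f c) (hf : Integrable f μ) : ∫ ω, f ω ∂μ ≤ c := by
  obtain ⟨g, hg, hfg, hgc⟩ := h
  exact (integral_mono hf hg hfg).trans hgc

end MeanLE

/-! ### Counting the visits to a decision in a block of slots -/

/-- Every visit increases the running count by one, so the counts seen at the visits are distinct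
integers in [0, M]. -/
lemma card_filter_pullSlots_le {K : ℕ} (sel : ℕ → Fin K) (k : Fin K) (a b : ℕ) {M : ℝ}
    (hM : 0 ≤ M) (s : Finset ℕ) (hs : ∀ n ∈ s, a ≤ n ∧ n < b ∧ sel n = k ∧
      ((pullSlots sel k a n).card : ℝ) ≤ M) : (s.card : ℝ) ≤ M + 1 := by
  have hlt : ∀ n n', n ∈ s → n < n' →
      (pullSlots sel k a n).card < (pullSlots sel k a n').card := by
    intro n n' hn hnn'
    obtain ⟨h1, -, h3, -⟩ := hs n hn
    refine Finset.card_lt_card (Finset.ssubset_iff_of_subset ?_ |>.2 ⟨n, ?_, ?_⟩)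
    · exact Finset.filter_subset_filter _ (Finset.Ico_subset_Ico_right hnn'.le)
    · simp [pullSlots, h1, h3, hnn']
    · simp [pullSlots]
  have h : s.card ≤ (Finset.range (⌊M⌋₊ + 1)).card := by
    refine Finset.card_le_card_of_injOn (fun n => (pullSlots sel k a n).card) ?_ ?_
    · intro n hn
      simp only [Finset.coe_range, Set.mem_Iio, Order.lt_add_one_iff]
      exact Nat.le_floor (hs n hn).2.2.2
    · intro n hn n' hn' h
      rcases lt_trichotomy n n' with h' | h' | h'
      · exact absurd h (hlt n n' hn h').ne
      · exact h'
      · exact absurd h (hlt n' n hn' h').ne'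
  rw [Finset.card_range] at h
  calc (s.card : ℝ) ≤ ((⌊M⌋₊ + 1 : ℕ) : ℝ) := by exact_mod_cast h
    _ ≤ M + 1 := by
      push_cast
      linarith [Nat.floor_le hM]

lemma excess_add {K : ℕ} (θ : ℕ → Fin K → ℝ) (x : ℕ → Fin K → Bool) (sel : ℕ → Fin K)
    (k : Fin K) {a b c : ℕ} (hab : a ≤ b) (hbc : b ≤ c) :
    excess θ x sel k a c = excess θ x sel k a b + excess θ x sel k b c := by
  simp only [excess_eq_sum_ite]
  exact (Finset.sum_Ico_consecutive _ hab hbc).symm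

lemma card_pullSlots_add {K : ℕ} (sel : ℕ → Fin K) (k : Fin K) {a b c : ℕ} (hab : a ≤ b)
    (hbc : b ≤ c) : ((pullSlots sel k a c).card : ℝ) =
      (pullSlots sel k a b).card + (pullSlots sel k b c).card := by
  simp only [card_pullSlots_eq_sum_ite]
  exact (Finset.sum_Ico_consecutive _ hab hbc).symm

lemma mul_exp_neg_mul_le {k x : ℝ} (hk : 0 < k) : x * Real.exp (-(k * x)) ≤ 1 / k := by
  have h := Real.add_one_le_exp (k * x)
  rw [Real.exp_neg, ← div_eq_mul_inv, div_le_div_iff₀ (Real.exp_pos _) hk]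
  linarith

open Classical in
/-- The expected number of visits to a decision in a block of `τ` slots, when a visit requires that
the decision was taken rarely in the window or that it was too successful there. -/
lemma meanLE_card_visits {Ω : Type*} {mΩ : MeasurableSpace Ω} {μ : Measure Ω}
    [IsProbabilityMeasure μ] {ℱ : Filtration ℕ mΩ} {K : ℕ} {θ : ℕ → Fin K → ℝ}
    {X : ℕ → Fin K → Ω → Bool} {sel : ℕ → Ω → Fin K} (hX : IsEnvironment μ ℱ θ X)
    (hsel : ∀ n, 1 ≤ n → Measurable[ℱ (n - 1)] (sel n)) (k : Fin K) {a τ : ℕ} (ha : 1 ≤ a)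
    (hτ : 0 < τ) {d L N : ℝ} (hd0 : 0 < d) (hd1 : d ≤ 1) (hL : 0 ≤ L) (hτL : Real.log τ ≤ L)
    (hN : N = L / (2 * d ^ 2)) {ρ ζ B u : ℝ} (hρ : 1 / 2 ≤ ρ) (hBu : B ≤ u) (hu0 : 0 ≤ u)
    (hu10 : u ≤ 10) (hu : ζ + 101 / (400 * ρ) + 1 / 100 ≤ (ρ - 1 / 100) * u)
    (hζ : 0 ≤ ζ) (hρζ0 : 0 ≤ ρ - ζ / 10)
    (hρζ : 1 ≤ 10 * (ρ - ζ / 10) ^ 2) (P : ℕ → Ω → Prop)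
    (hP : ∀ n ω, a ≤ n → n < a + τ → P n ω → sel n ω = k ∧
      (((pullSlots (fun t => sel t ω) k (max 1 (n - τ)) n).card : ℝ) ≤ B * N ∨
        d * (ρ * (pullSlots (fun t => sel t ω) k (max 1 (n - τ)) n).card - ζ * N) ≤
          excess θ (fun t k => X t k ω) (fun t => sel t ω) k (max 1 (n - τ)) n)) :
    MeanLE μ (fun ω => ((((Finset.Ico a (a + τ)).filter fun n => P n ω).card : ℕ) : ℝ))
      ((u * L + 26008) / (2 * d ^ 2)) := by
  have hτ0 : (0 : ℝ) < τ := by exact_mod_cast hτ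
  have hN0 : 0 ≤ N := by rw [hN]; positivity
  have hNL : 2 * d ^ 2 * N = L := by rw [hN]; field_simp
  have hτexp : (τ : ℝ) * Real.exp (-L) ≤ 1 := by
    rw [Real.log_le_iff_le_exp hτ0] at hτL
    rw [Real.exp_neg, ← div_eq_mul_inv, div_le_one (Real.exp_pos _)]
    exact hτL
  set c : Ω → ℕ → ℕ → ℝ := fun ω i j => ((pullSlots (fun t => sel t ω) k i j).card : ℝ) with hc
  set e : Ω → ℕ → ℕ → ℝ := fun ω i j =>
    excess θ (fun t k => X t k ω) (fun t => sel t ω) k i j with he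
  set W : ℕ → ℕ := fun n => max 1 (n - τ) with hW
  -- Since a block is no longer than the window, the window at `n` contains all earlier slots of the
  -- block. It splits at `a` into an older part and the part inside the block.
  have hWa : ∀ n, n < a + τ → W n ≤ a := fun n hn => max_le ha (by omega)
  have hW1 : ∀ n, 1 ≤ W n := fun n => le_max_left _ _
  have hWn : ∀ n, 1 ≤ n → W n ≤ n := fun n hn => max_le hn (by omega)
  -- `O n`: large excess in the older part of the window. The slope `ρ * d` matches the requirement
  -- on a visit, so the older count cancels later; the factor 101/100 lets the bound survive the
  -- union over τ slots. `Q`: even a small excess inside the block, treated by the maximal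
  -- inequality at once for all `n`. `F n`: a visit with at least `10 * N` samples.
  set O : ℕ → Set Ω := fun n => {ω | ρ * d * c ω (W n) a + 101 / 100 * (d * N / (4 * ρ)) ≤
    e ω (W n) a} with hO
  set Q : Set Ω := {ω | ∃ n, a ≤ n ∧ n < a + τ ∧ 1 / 100 * d * (c ω a n + N) ≤ e ω a n} with hQ
  set F : ℕ → Set Ω := fun n => {ω | 10 * N ≤ c ω (W n) n ∧
    d * (ρ * c ω (W n) n - ζ * N) ≤ e ω (W n) n} with hF
  set E : Set Ω := (⋃ n ∈ Finset.Ico a (a + τ), O n) ∪ Q with hE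
  have hOP : ∀ n, n < a + τ → μ.real (O n) ≤ Real.exp (-(101 / 100 * L)) := by
    intro n hn
    refine (measureReal_mono ?_ (measure_ne_top _ _)).trans
      (measureReal_exists_excess_le hX hsel k (hW1 n) (hWa n hn) (8 * ρ * d) (101 / 100 * L))
    intro ω hω
    refine ⟨a, hWa n hn, le_rfl, ?_⟩
    have h : ρ * d * c ω (W n) a + 101 / 100 * (d * N / (4 * ρ)) ≤ e ω (W n) a := hω
    have h2 := mul_le_mul_of_nonneg_left h (show 0 ≤ 8 * ρ * d by positivity)
    have h3 : 8 * ρ * d * (101 / 100 * (d * N / (4 * ρ))) = 101 / 100 * (2 * d ^ 2 * N) := by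
      field_simp
      ring
    rw [mul_add, h3, hNL] at h2
    change 101 / 100 * L ≤ 8 * ρ * d * e ω (W n) a - (8 * ρ * d) ^ 2 / 8 * c ω (W n) a
    linarith
  have hQP : μ.real Q ≤ Real.exp (-(1 / 2500 * L)) := by
    refine (measureReal_mono ?_ (measure_ne_top _ _)).trans
      (measureReal_exists_excess_le hX hsel k ha (b := a + τ) (by omega) (8 / 100 * d)
        (1 / 2500 * L))
    rintro ω ⟨n, hn1, hn2, h⟩
    refine ⟨n, hn1, hn2.le, ?_⟩
    have h2 := mul_le_mul_of_nonneg_left h (show 0 ≤ 8 / 100 * d by positivity)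
    change 1 / 2500 * L ≤ 8 / 100 * d * e ω a n - (8 / 100 * d) ^ 2 / 8 * c ω a n
    rw [← hNL]
    linarith
  have hFP : ∀ n, a ≤ n → μ.real (F n) ≤ Real.exp (-L) := by
    intro n hn
    set β := ρ - ζ / 10 with hβ
    refine (measureReal_mono ?_ (measure_ne_top _ _)).trans
      (measureReal_exists_excess_le hX hsel k (hW1 n) (hWn n (by omega)) (4 * β * d) L)
    rintro ω ⟨h1, h2⟩
    refine ⟨n, hWn n (by omega), le_rfl, ?_⟩
    change L ≤ 4 * β * d * e ω (W n) n - (4 * β * d) ^ 2 / 8 * c ω (W n) n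
    have h3 : d * (β * c ω (W n) n) ≤ e ω (W n) n := by
      refine le_trans ?_ h2
      refine mul_le_mul_of_nonneg_left ?_ hd0.le
      rw [hβ]
      nlinarith
    have h4 := mul_le_mul_of_nonneg_left h3 (show 0 ≤ 4 * β * d by positivity)
    have h5 := mul_le_mul_of_nonneg_left h1 (show 0 ≤ 2 * β ^ 2 * d ^ 2 by positivity)
    have h6 := mul_le_mul_of_nonneg_right hρζ hL
    rw [← hNL] at h6 ⊢
    linarith
  have hEP : μ.real E ≤ Real.exp (-(1 / 100 * L)) + Real.exp (-(1 / 2500 * L)) := by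
    refine (measureReal_union_le _ _).trans (add_le_add ?_ hQP)
    refine (measureReal_biUnion_finset_le _ _).trans ?_
    calc ∑ n ∈ Finset.Ico a (a + τ), μ.real (O n)
        ≤ ∑ n ∈ Finset.Ico a (a + τ), Real.exp (-(101 / 100 * L)) :=
          Finset.sum_le_sum fun n hn => hOP n (Finset.mem_Ico.1 hn).2
      _ = (τ * Real.exp (-L)) * Real.exp (-(1 / 100 * L)) := by
          rw [Finset.sum_const, Nat.card_Ico, nsmul_eq_mul, mul_assoc, ← Real.exp_add]
          congr 1
          · congr 1; omega
          · congr 1; ring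
      _ ≤ 1 * Real.exp (-(1 / 100 * L)) := by gcongr
      _ = _ := one_mul _
  have hpoint : ∀ ω, ((((Finset.Ico a (a + τ)).filter fun n => P n ω).card : ℕ) : ℝ) ≤
      ((u * N + 1) + (10 * N + 1) * (if ω ∈ E then 1 else 0)) +
        ∑ n ∈ Finset.Ico a (a + τ), (if ω ∈ F n then 1 else 0) := by
    intro ω
    have hcsub : ∀ n, a ≤ n → n < a + τ → c ω a n ≤ c ω (W n) n := by
      intro n h1 h2
      have := card_pullSlots_add (fun t => sel t ω) k (hWa n h2) h1
      have h0 : 0 ≤ c ω (W n) a := Nat.cast_nonneg _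
      simp only [hc] at h0 ⊢
      linarith
    by_cases hωE : ω ∈ E
    · rw [← Finset.card_filter_add_card_filter_not (s := (Finset.Ico a (a + τ)).filter fun n =>
        P n ω) (fun n => ω ∈ F n), Nat.cast_add]
      have h1 : (((((Finset.Ico a (a + τ)).filter fun n => P n ω).filter
          fun n => ω ∈ F n).card : ℕ) : ℝ) ≤
          ∑ n ∈ Finset.Ico a (a + τ), (if ω ∈ F n then (1 : ℝ) else 0) := by
        rw [Finset.sum_boole]
        exact_mod_cast Finset.card_le_card
          (Finset.filter_subset_filter _ (Finset.filter_subset _ _))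
      have h2 : (((((Finset.Ico a (a + τ)).filter fun n => P n ω).filter
          fun n => ¬ ω ∈ F n).card : ℕ) : ℝ) ≤ 10 * N + 1 := by
        refine card_filter_pullSlots_le (fun t => sel t ω) k a (a + τ) (by positivity) _ ?_
        intro n hn
        simp only [Finset.mem_filter, Finset.mem_Ico] at hn
        obtain ⟨⟨⟨hn1, hn2⟩, hPn⟩, hnF⟩ := hn
        obtain ⟨hs, h⟩ := hP n ω hn1 hn2 hPn
        refine ⟨hn1, hn2, hs, (hcsub n hn1 hn2).trans ?_⟩
        rcases h with h | h
        · exact h.trans (mul_le_mul_of_nonneg_right (hBu.trans hu10) hN0)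
        · by_contra! h'
          exact hnF ⟨h'.le, h⟩
      rw [if_pos hωE, mul_one]
      have : 0 ≤ u * N := mul_nonneg hu0 hN0
      linarith
    · rw [if_neg hωE, mul_zero, add_zero]
      have h1 : ((((Finset.Ico a (a + τ)).filter fun n => P n ω).card : ℕ) : ℝ) ≤ u * N + 1 := by
        refine card_filter_pullSlots_le (fun t => sel t ω) k a (a + τ) (mul_nonneg hu0 hN0) _ ?_
        intro n hn
        simp only [Finset.mem_filter, Finset.mem_Ico] at hn
        obtain ⟨⟨hn1, hn2⟩, hPn⟩ := hn
        obtain ⟨hs, h⟩ := hP n ω hn1 hn2 hPn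
        refine ⟨hn1, hn2, hs, ?_⟩
        rcases h with h | h
        · exact (hcsub n hn1 hn2).trans (h.trans (mul_le_mul_of_nonneg_right hBu hN0))
        · have hO' : ω ∉ O n := fun h' => hωE (Or.inl (Set.mem_biUnion
            (Finset.mem_coe.2 (Finset.mem_Ico.2 ⟨hn1, hn2⟩)) h'))
          have hQ' : ω ∉ Q := fun h' => hωE (Or.inr h')
          have g1 : e ω (W n) a < ρ * d * c ω (W n) a + 101 / 100 * (d * N / (4 * ρ)) :=
            not_le.1 hO'
          have g2 : e ω a n < 1 / 100 * d * (c ω a n + N) := by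
            by_contra! h'
            exact hQ' ⟨n, hn1, hn2, h'⟩
          have g3 : e ω (W n) n = e ω (W n) a + e ω a n :=
            excess_add θ _ _ k (hWa n hn2) hn1
          have g4 : c ω (W n) n = c ω (W n) a + c ω a n :=
            card_pullSlots_add _ k (hWa n hn2) hn1
          have g5 : d * (ρ * c ω (W n) n - ζ * N) ≤ e ω (W n) n := h
          have g6 : 101 / 100 * (d * N / (4 * ρ)) = d * (101 / (400 * ρ) * N) := by
            field_simp
            ring
          rw [g3, g4] at g5
          rw [g6] at g1
          -- The count of the older part has cancelled; only the count inside the block remains,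
          -- which is why `hu` has this form.
          have g7 : d * ((ρ - 1 / 100) * c ω a n) <
              d * ((ζ + 101 / (400 * ρ) + 1 / 100) * N) := by linarith
          have g8 := lt_of_mul_lt_mul_left g7 hd0.le
          have g9 := mul_le_mul_of_nonneg_right hu hN0
          rw [mul_assoc] at g9
          exact le_of_mul_le_mul_left (g8.le.trans g9) (by linarith)
      refine h1.trans (le_add_of_nonneg_right (Finset.sum_nonneg fun n _ => ?_))
      split_ifs <;> norm_num
  have hmean := ((MeanLE.const (μ := μ) (u * N + 1)).add ((MeanLE.of_measureReal_le hEP).const_mul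
    (show 0 ≤ 10 * N + 1 by positivity))).add (MeanLE.sum (Finset.Ico a (a + τ)) fun n hn =>
      MeanLE.of_measureReal_le (hFP n (Finset.mem_Ico.1 hn).1))
  refine hmean.mono (fun ω => (hpoint ω).trans (le_of_eq (by congr!))) ?_
  rw [Finset.sum_const, Nat.card_Ico, nsmul_eq_mul, Nat.add_sub_cancel_left]
  -- The exceptional event `E` costs about `10 * N` times its probability. Since x e^{-κx} ≤ 1/κ,
  -- this is at most 10(100 + 2500)/(2d²); the four remaining terms bounded by 1 add 8, as d ≤ 1.
  -- Hence 26008.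
  have k1 := mul_exp_neg_mul_le (k := 1 / 100) (x := L) (by norm_num)
  have k2 := mul_exp_neg_mul_le (k := 1 / 2500) (x := L) (by norm_num)
  have k3 : Real.exp (-(1 / 100 * L)) ≤ 1 := Real.exp_le_one_iff.2 (by linarith)
  have k4 : Real.exp (-(1 / 2500 * L)) ≤ 1 := Real.exp_le_one_iff.2 (by linarith)
  have hd2 : d ^ 2 ≤ 1 := pow_le_one₀ hd0.le hd1
  rw [le_div_iff₀ (by positivity)]
  rw [← hNL] at k1 k2 k3 k4 ⊢
  set x1 := Real.exp (-(1 / 100 * (2 * d ^ 2 * N)))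
  set x2 := Real.exp (-(1 / 2500 * (2 * d ^ 2 * N)))
  rw [← hNL] at hτexp
  have k5 := mul_le_mul_of_nonneg_left hτexp (show 0 ≤ 2 * d ^ 2 by positivity)
  have k6 := mul_le_mul_of_nonneg_left k3 (show 0 ≤ 2 * d ^ 2 by positivity)
  have k7 := mul_le_mul_of_nonneg_left k4 (show 0 ≤ 2 * d ^ 2 by positivity)
  linarith

/-! ### The index -/

section Index

variable {K : ℕ} {r : Fin K → ℝ} {τ : ℕ} {c : ℝ} {x : ℕ → Fin K → Bool} {sel : ℕ → Fin K} {n : ℕ}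
  {k : Fin K}

lemma empMean_div (hr : 0 < r k) : empMean r τ x sel n k / r k =
    (successes x sel k (max 1 (n - τ)) n : ℝ) / (pulls τ sel n k : ℝ) := by
  have : (∑ t ∈ (window τ n).filter fun t => sel t = k, r k * (if x t k = true then (1 : ℝ) else 0))
      = r k * (successes x sel k (max 1 (n - τ)) n : ℝ) := by
    rw [← Finset.mul_sum, Finset.sum_boole]
    rfl
  rw [empMean, this]
  field_simp

lemma successes_le (a b : ℕ) : successes x sel k a b ≤ (pullSlots sel k a b).card :=
  Finset.card_filter_le _ _

lemma excess_eq_sub (θ : ℕ → Fin K → ℝ) (a b : ℕ) : excess θ x sel k a b =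
    successes x sel k a b - ∑ t ∈ pullSlots sel k a b, θ t k := by
  rw [excess, Finset.sum_sub_distrib, Finset.sum_boole]
  rfl

lemma le_excess {θ : ℕ → Fin K → ℝ} {a b : ℕ} {p : ℝ}
    (hp : ∀ t, a ≤ t → t < b → θ t k ≤ p) : (successes x sel k a b : ℝ) -
      (pullSlots sel k a b).card * p ≤ excess θ x sel k a b := by
  rw [excess_eq_sub]
  have : ∑ t ∈ pullSlots sel k a b, θ t k ≤ ∑ t ∈ pullSlots sel k a b, p := by
    refine Finset.sum_le_sum fun t ht => ?_
    simp only [pullSlots, Finset.mem_filter, Finset.mem_Ico] at ht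
    exact hp t ht.1.1 ht.1.2
  rw [Finset.sum_const, nsmul_eq_mul] at this
  linarith

lemma empMean_div_mem (hr : 0 < r k) : empMean r τ x sel n k / r k ∈ Set.Icc (0 : ℝ) 1 := by
  rw [empMean_div hr]
  refine ⟨by positivity, div_le_one_of_le₀ ?_ (Nat.cast_nonneg _)⟩
  exact_mod_cast successes_le _ _

/-- Uses the nonnegativity of the level: the feasible set is nonempty, so the index is a genuine
supremum. -/
lemma empMean_mem_index_set (hr : 0 < r k) (hL : 0 ≤ level τ c) :
    empMean r τ x sel n k ∈ {q : ℝ | q ∈ Set.Icc 0 (r k) ∧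
      ((pulls τ sel n k : ℝ) : EReal) * bernoulliKL (empMean r τ x sel n k / r k) (q / r k)
        ≤ (level τ c : EReal)} := by
  obtain ⟨h0, h1⟩ := empMean_div_mem (x := x) (sel := sel) (n := n) (τ := τ) hr
  refine ⟨⟨by simpa using (le_div_iff₀ hr).1 h0, by simpa using (div_le_iff₀ hr).1 h1⟩, ?_⟩
  rw [bernoulliKL_self, mul_zero]
  exact_mod_cast hL

lemma klIndex_le (hr : 0 < r k) (hL : 0 ≤ level τ c) {b : ℝ}
    (h : ∀ y, 0 ≤ y → y ≤ 1 → ((pulls τ sel n k : ℝ) : EReal) *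
      bernoulliKL (empMean r τ x sel n k / r k) y ≤ (level τ c : EReal) → r k * y ≤ b) :
    klIndex r τ c x sel n k ≤ b := by
  refine csSup_le ⟨_, empMean_mem_index_set hr hL⟩ ?_
  rintro q ⟨⟨hq0, hq1⟩, hq⟩
  have := h (q / r k) (by positivity) ((div_le_one hr).2 hq1) hq
  rwa [mul_div_cancel₀ _ hr.ne'] at this

lemma bddAbove_index_set : BddAbove {q : ℝ | q ∈ Set.Icc 0 (r k) ∧
      ((pulls τ sel n k : ℝ) : EReal) * bernoulliKL (empMean r τ x sel n k / r k) (q / r k)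
        ≤ (level τ c : EReal)} :=
  ⟨r k, fun _ hq => hq.1.2⟩

lemma klIndex_le_self (hr : 0 < r k) (hL : 0 ≤ level τ c) : klIndex r τ c x sel n k ≤ r k :=
  klIndex_le hr hL fun y _ hy _ => by nlinarith

lemma empMean_le_klIndex (hr : 0 < r k) (hL : 0 ≤ level τ c) :
    empMean r τ x sel n k ≤ klIndex r τ c x sel n k :=
  le_csSup bddAbove_index_set (empMean_mem_index_set hr hL)

lemma klIndex_nonneg (hr : 0 < r k) (hL : 0 ≤ level τ c) : 0 ≤ klIndex r τ c x sel n k := by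
  refine le_trans ?_ (empMean_le_klIndex hr hL)
  have h0 := (empMean_div_mem (x := x) (sel := sel) (n := n) (τ := τ) hr).1
  simpa using (le_div_iff₀ hr).1 h0

/-- An index below `r k * y` means that `y` violates the divergence constraint. Without samples the
constraint would hold trivially. -/
lemma level_lt_of_klIndex_lt (hr : 0 < r k) (hL : 0 ≤ level τ c) {y : ℝ} (hy0 : 0 < y)
    (hy1 : y < 1) (h : klIndex r τ c x sel n k < r k * y) :
    1 ≤ pulls τ sel n k ∧
    (successes x sel k (max 1 (n - τ)) n : ℝ) / (pulls τ sel n k : ℝ) < y ∧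
    level τ c < (pulls τ sel n k : ℝ) *
      klReal ((successes x sel k (max 1 (n - τ)) n : ℝ) / (pulls τ sel n k : ℝ)) y := by
  have hnot : ¬ ((pulls τ sel n k : ℝ) : EReal) * bernoulliKL (empMean r τ x sel n k / r k) y
        ≤ (level τ c : EReal) := by
    intro h'
    refine absurd (le_csSup (bddAbove_index_set (r := r) (τ := τ) (c := c) (x := x) (sel := sel)
      (n := n) (k := k)) (a := r k * y) ⟨⟨by positivity, by nlinarith⟩, ?_⟩) (not_le.2 h)
    rwa [mul_div_cancel_left₀ _ hr.ne']
  rw [bernoulliKL_eq_coe hy0 hy1, empMean_div hr, ← EReal.coe_mul, EReal.coe_le_coe_iff,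
    not_le] at hnot
  refine ⟨?_, ?_, hnot⟩
  · by_contra! h0
    have : pulls τ sel n k = 0 := by omega
    rw [this] at hnot
    simp only [Nat.cast_zero, zero_mul] at hnot
    linarith
  · rw [← empMean_div hr, div_lt_iff₀ hr, mul_comm]
    exact (empMean_le_klIndex hr hL).trans_lt h

/-- A decision with a large index that is taken in the window was too successful there. -/
lemma excess_ge_of_le_klIndex {θ : ℕ → Fin K → ℝ} {p d R N η : ℝ}
    (hp : ∀ t, max 1 (n - τ) ≤ t → t < n → θ t k ≤ p) (hr : 0 < r k) (hrR : r k ≤ R)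
    (hL : 0 ≤ level τ c) (hd : 0 < d) (hN : level τ c = 2 * d ^ 2 * N)
    (hη1 : η ≤ 1 / 200)
    (hidx : r k * p + (1 - η) * (d * R) ≤ klIndex r τ c x sel n k) :
    ((pullSlots sel k (max 1 (n - τ)) n).card : ℝ) ≤ 0 * N ∨
      d * (33 / 50 * (pullSlots sel k (max 1 (n - τ)) n).card - 3 / 4 * N) ≤
        excess θ x sel k (max 1 (n - τ)) n := by
  rcases Nat.eq_zero_or_pos (pullSlots sel k (max 1 (n - τ)) n).card with hs | hs
  · left; simp [hs]
  right
  refine le_trans ?_ (le_excess hp)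
  have hN0 : 0 ≤ N := by
    by_contra! h
    have : 2 * d ^ 2 * N < 0 := mul_neg_of_pos_of_neg (by positivity) h
    linarith
  set s : ℝ := ((pullSlots sel k (max 1 (n - τ)) n).card : ℝ) with hsdef
  have hs0 : 0 < s := (Nat.cast_pos (α := ℝ)).2 hs
  set ph : ℝ := (successes x sel k (max 1 (n - τ)) n : ℝ) / s with hph
  obtain ⟨hp0, hp1⟩ := empMean_div_mem (x := x) (sel := sel) (n := n) (τ := τ) hr
  -- Pinsker bounds the deviation y - ph by d√(N/s), and the arithmetic-geometric mean inequality
  -- gives √(N/s) ≤ 1/3 + 3N/(4s). This makes the condition linear in the number `s` of samples.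
  have hup : klIndex r τ c x sel n k ≤ r k * (ph + d * (1 / 3 + 3 * N / (4 * s))) := by
    refine klIndex_le hr hL fun y hy0 hy1 hy => mul_le_mul_of_nonneg_left ?_ hr.le
    have hpk := two_mul_sq_le_bernoulliKL hp0 hp1 hy0 hy1
    have h2 : ((s : ℝ) : EReal) * ((2 * (y - empMean r τ x sel n k / r k) ^ 2 : ℝ) : EReal) ≤
        (level τ c : EReal) :=
      (mul_le_mul_of_nonneg_left hpk (by exact_mod_cast hs0.le)).trans hy
    rw [← EReal.coe_mul, EReal.coe_le_coe_iff, empMean_div hr] at h2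
    change s * (2 * (y - ph) ^ 2) ≤ level τ c at h2
    have h3 : ((y - ph) * s) ^ 2 ≤ (d * (s / 3 + 3 / 4 * N)) ^ 2 := by
      have h4 : s * (y - ph) ^ 2 ≤ d ^ 2 * N := by linarith
      have h5 := mul_le_mul_of_nonneg_left h4 hs0.le
      have h6 : 0 ≤ d ^ 2 * (s / 3 - 3 / 4 * N) ^ 2 := by positivity
      nlinarith
    have h7 := abs_le_of_sq_le_sq h3 (by positivity)
    have h8 := (le_abs_self _).trans h7
    have h9 : d * (1 / 3 + 3 * N / (4 * s)) = d * (s / 3 + 3 / 4 * N) / s := by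
      field_simp
    rw [h9, ← sub_le_iff_le_add', le_div_iff₀ hs0]
    exact h8
  have h1 : r k * (p + (1 - η) * d) ≤ r k * (ph + d * (1 / 3 + 3 * N / (4 * s))) := by
    refine le_trans ?_ (hidx.trans hup)
    have : (1 - η) * d * r k ≤ (1 - η) * d * R :=
      mul_le_mul_of_nonneg_left hrR (mul_nonneg (by linarith) hd.le)
    linarith
  have h2 := mul_le_mul_of_nonneg_right (le_of_mul_le_mul_left h1 hr) hs0.le
  have h3 : (ph + d * (1 / 3 + 3 * N / (4 * s))) * s =
      (successes x sel k (max 1 (n - τ)) n : ℝ) + d * (s / 3 + 3 / 4 * N) := by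
    rw [hph]
    field_simp
  rw [h3] at h2
  have h4 : (33 / 50 : ℝ) * (d * s) ≤ (1 - η - 1 / 3) * (d * s) :=
    mul_le_mul_of_nonneg_right (by linarith) (by positivity)
  linarith

/-- If the index of a decision is close to its rate, then it rarely failed in the window. -/
lemma excess_ge_of_rate_le {θ : ℕ → Fin K → ℝ} {p d R N Y : ℝ}
    (hp : ∀ t, max 1 (n - τ) ≤ t → t < n → θ t k ≤ p) (hp0 : 0 ≤ p) (hr : 0 < r k) (hrR : r k ≤ R)
    (hL : 0 ≤ level τ c) (hd : 0 < d) (hd1 : d ≤ 1) (hN : level τ c = 2 * d ^ 2 * N)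
    (hY1 : r k * p + d * R ≤ Y) (hrY : r k ≤ Y)
    (hidx : Y - Real.exp (-80) * (d * R) ≤ klIndex r τ c x sel n k) :
    ((pullSlots sel k (max 1 (n - τ)) n).card : ℝ) ≤ 1 / 3 * N ∨
      d * (9 / 10 * (pullSlots sel k (max 1 (n - τ)) n).card - 0 * N) ≤
        excess θ x sel k (max 1 (n - τ)) n := by
  by_contra! hcon
  obtain ⟨hsN, hexc⟩ := hcon
  have hR : 0 < R := by linarith
  have hη0 := Real.exp_pos (-80)
  set η := Real.exp (-80) with hη
  have hη1 : η ≤ 1 / 100 := by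
    rw [hη, Real.exp_neg, ← one_div]
    exact one_div_le_one_div_of_le (by norm_num)
      (by linarith [Real.quadratic_le_exp_of_nonneg (show (0 : ℝ) ≤ 80 by norm_num)])
  have hN0 : 0 ≤ N := by
    by_contra! h
    have : 2 * d ^ 2 * N < 0 := mul_neg_of_pos_of_neg (by positivity) h
    linarith
  set s : ℝ := ((pullSlots sel k (max 1 (n - τ)) n).card : ℝ) with hsdef
  have hs0 : 0 < s := by linarith
  have hexc' := (le_excess (x := x) (sel := sel) hp).trans_lt hexc
  set ph : ℝ := (successes x sel k (max 1 (n - τ)) n : ℝ) / s with hph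
  have hsucc : (successes x sel k (max 1 (n - τ)) n : ℝ) = ph * s := by
    rw [hph]; field_simp
  rw [hsucc] at hexc'
  have hph1 : ph < p + 9 / 10 * d := by
    have : s * ph < s * (p + 9 / 10 * d) := by
      change ph * s - s * p < _ at hexc'
      linarith
    exact lt_of_mul_lt_mul_left this hs0.le
  obtain ⟨hph0', -⟩ := empMean_div_mem (x := x) (sel := sel) (n := n) (τ := τ) hr
  have hpheq : empMean r τ x sel n k / r k = ph := empMean_div hr
  rw [hpheq] at hph0'
  set w := d * R / r k with hw
  have hwr : r k * w = d * R := by rw [hw]; field_simp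
  have hdw : d ≤ w := by
    rw [hw, le_div_iff₀ hr]
    exact mul_le_mul_of_nonneg_left hrR hd.le
  have hself := klIndex_le_self (x := x) (sel := sel) (n := n) hr hL
  -- The index cannot exceed the rate, so the target `Y` is at most r_k + ηdR. The gap dR, in units
  -- of the rate, must therefore almost fit between `p` and 1, and `ph` stays away from 1.
  have hpw : (1 - η) * w ≤ 1 - p := by
    have : r k * ((1 - η) * w) ≤ r k * (1 - p) := by
      rw [mul_left_comm, hwr]
      linarith
    exact le_of_mul_le_mul_left this hr
  have hw0 : 0 < w := by linarith
  have hηw : η * w ≤ 1 / 100 * w := mul_le_mul_of_nonneg_right hη1 hw0.le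
  have hphw : 9 / 100 * w ≤ 1 - ph := by linarith
  have hw2 : w ≤ 2 := by linarith
  -- For y above this level, (1 - ph)/(1 - y) ≥ (9/200) e^{80} ≥ e^{76}, so the divergence is at
  -- least 6.75w. With more than N/3 samples the total exceeds 6ws, whereas L = 2d²N < 6ws.
  have hup : klIndex r τ c x sel n k ≤ r k * (1 - 2 * η * w) := by
    refine klIndex_le hr hL fun y hy0 hy1 hy => mul_le_mul_of_nonneg_left ?_ hr.le
    by_contra! hlt
    have hypos : 0 < y := by linarith
    rw [hpheq] at hy
    change ((s : ℝ) : EReal) * _ ≤ _ at hy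
    rcases hy1.eq_or_lt with rfl | hy1
    · rw [bernoulliKL, if_pos (Or.inr ⟨rfl, by linarith⟩), EReal.coe_mul_top_of_pos hs0] at hy
      exact absurd hy (not_le.2 (EReal.coe_lt_top _))
    rw [bernoulliKL_eq_coe hypos hy1, ← EReal.coe_mul, EReal.coe_le_coe_iff] at hy
    have hkl := mul_log_sub_one_le_klReal hph0' hypos hy1
    have hlog : 76 ≤ Real.log ((1 - ph) / (1 - y)) := by
      rw [Real.le_log_iff_exp_le (div_pos (by linarith) (by linarith)), le_div_iff₀ (by linarith)]
      have e1 : Real.exp 76 * η = Real.exp (-4) := by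
        rw [hη, ← Real.exp_add]; norm_num
      have e2 : Real.exp (-4) ≤ 9 / 200 := by
        have h1 := Real.exp_one_gt_d9
        have h2 : Real.exp 4 = Real.exp 1 ^ 4 := by
          rw [← Real.exp_nat_mul]; norm_num
        have h3 : (2.7 : ℝ) ^ 4 ≤ Real.exp 1 ^ 4 :=
          pow_le_pow_left₀ (by norm_num) (by linarith) 4
        rw [Real.exp_neg, inv_le_comm₀ (Real.exp_pos _) (by norm_num), h2]
        refine le_trans ?_ h3
        norm_num
      have e3 : Real.exp 76 * (1 - y) ≤ Real.exp 76 * (2 * η * w) :=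
        mul_le_mul_of_nonneg_left (by linarith) (Real.exp_pos _).le
      have e4 : Real.exp 76 * (2 * η * w) = 2 * w * Real.exp (-4) := by rw [← e1]; ring
      have e5 : 2 * w * Real.exp (-4) ≤ 2 * w * (9 / 200) :=
        mul_le_mul_of_nonneg_left e2 (by linarith)
      linarith
    have h1 : 9 / 100 * w * 75 ≤ klReal ph y := by
      refine le_trans ?_ hkl
      exact mul_le_mul hphw (by linarith) (by norm_num) (by linarith)
    have h2 := mul_le_mul_of_nonneg_left h1 hs0.le
    have h3 : d ^ 2 ≤ w := by nlinarith
    have h4 : 2 * d ^ 2 * N < 2 * w * (3 * s) := by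
      have : 2 * d ^ 2 * N ≤ 2 * w * N := mul_le_mul_of_nonneg_right (by linarith) hN0
      refine this.trans_lt (mul_lt_mul_of_pos_left (by linarith) (by linarith))
    have h5 : 0 < s * w := mul_pos hs0 hw0
    linarith
  have h5 : r k * (1 - 2 * η * w) = r k - 2 * η * (d * R) := by rw [← hwr]; ring
  have h6 : 0 < η * (d * R) := by positivity
  linarith

end Index

/-! ### Lower deviations of the index -/

lemma mul_sum_exp_neg_le {a : ℝ} (ha : 0 < a) (n : ℕ) :
    ∑ s ∈ Finset.Icc 1 n, Real.exp (-(a * s)) ≤ 1 / a := by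
  have h : a * ∑ s ∈ Finset.Icc 1 n, Real.exp (-(a * s)) ≤ 1 - Real.exp (-(a * n)) := by
    induction n with
    | zero => simp
    | succ n ih =>
      rw [Finset.sum_Icc_succ_top (by omega), mul_add]
      have h1 := Real.add_one_le_exp a
      have h2 : Real.exp (-(a * n)) = Real.exp (-(a * ((n + 1 : ℕ) : ℝ))) * Real.exp a := by
        rw [← Real.exp_add]; congr 1; push_cast; ring
      have h3 := Real.exp_pos (-(a * ((n + 1 : ℕ) : ℝ)))
      nlinarith
  rw [le_div_iff₀ ha]
  linarith [Real.exp_pos (-(a * n))]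

/-- The index of a decision rarely falls below its mean reward. -/
lemma measureReal_klIndex_lt_le {Ω : Type*} {mΩ : MeasurableSpace Ω} {μ : Measure Ω}
    [IsProbabilityMeasure μ] {ℱ : Filtration ℕ mΩ} {K : ℕ} {θ : ℕ → Fin K → ℝ}
    {X : ℕ → Fin K → Ω → Bool} {sel : ℕ → Ω → Fin K} (hX : IsEnvironment μ ℱ θ X)
    (hsel : ∀ n, 1 ≤ n → Measurable[ℱ (n - 1)] (sel n)) {r : Fin K → ℝ} {k : Fin K} (hr : 0 < r k)
    {τ : ℕ} {c : ℝ} (hL : 0 ≤ level τ c) {n : ℕ} (hn : 1 ≤ n) {y p : ℝ} (hyp : y < p)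
    (hp1 : p < 1) (hp : ∀ t, max 1 (n - τ) ≤ t → t < n → p ≤ θ t k) :
    μ.real {ω | klIndex r τ c (fun t k => X t k ω) (fun t => sel t ω) n k < r k * y} ≤
      Real.exp (-level τ c) * (1 / (2 * (p - y) ^ 2)) := by
  classical
  rcases le_or_gt y 0 with hy0 | hy0
  · have : {ω | klIndex r τ c (fun t k => X t k ω) (fun t => sel t ω) n k < r k * y} = ∅ := by
      ext ω
      simp only [Set.mem_ofPred_eq, Set.mem_empty_iff_false, iff_false, not_lt]
      exact (mul_nonpos_of_nonneg_of_nonpos hr.le hy0).trans (klIndex_nonneg hr hL)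
    rw [this, measureReal_empty]
    positivity
  set w := max 1 (n - τ) with hw
  have hw1 : 1 ≤ w := le_max_left _ _
  have hwn : w ≤ n := max_le hn (Nat.sub_le _ _)
  set ε := p - y with hε
  have hε0 : 0 < ε := by linarith
  set cn : Ω → ℕ := fun ω => (pullSlots (fun t => sel t ω) k w n).card with hcn
  set sc : Ω → ℕ := fun ω => successes (fun t k => X t k ω) (fun t => sel t ω) k w n with hsc
  -- The sample count is random, hence a union over its values `s`, each handled by the Chernoff
  -- bound for exactly `s` samples.
  set A : ℕ → Set Ω := fun s => {ω | cn ω = s ∧ (sc ω : ℝ) / s < y ∧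
    level τ c < s * klReal ((sc ω : ℝ) / s) y} with hA
  have hsub : {ω | klIndex r τ c (fun t k => X t k ω) (fun t => sel t ω) n k < r k * y} ⊆
      ⋃ s ∈ Finset.Icc 1 n, A s := by
    intro ω hω
    obtain ⟨h1, h2, h3⟩ := level_lt_of_klIndex_lt hr hL hy0 (by linarith) hω
    refine Set.mem_biUnion (x := cn ω) (Finset.mem_coe.2 (Finset.mem_Icc.2 ⟨h1, ?_⟩))
      ⟨rfl, h2, h3⟩
    calc cn ω ≤ (Finset.Ico w n).card := Finset.card_filter_le _ _
      _ ≤ n := by rw [Nat.card_Ico]; omega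
  have hAP : ∀ s ∈ Finset.Icc 1 n, μ.real (A s) ≤
      Real.exp (-level τ c) * Real.exp (-(2 * ε ^ 2 * s)) := by
    intro s hs
    have hs1 := (Finset.mem_Icc.1 hs).1
    have hs0 : (0 : ℝ) < s := by exact_mod_cast hs1
    set M : Finset ℕ := (Finset.range (s + 1)).filter fun m =>
      (m : ℝ) / s < y ∧ level τ c < s * klReal ((m : ℝ) / s) y with hM
    have hscM : ∀ ω ∈ A s, sc ω ∈ M := by
      rintro ω ⟨h1, h2, h3⟩
      refine Finset.mem_filter.2 ⟨Finset.mem_range.2 ?_, h2, h3⟩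
      have : sc ω ≤ cn ω := successes_le _ _
      omega
    rcases M.eq_empty_or_nonempty with hMe | hMne
    · have : A s = ∅ := by
        ext ω
        simp only [Set.mem_empty_iff_false, iff_false]
        intro hω
        have := hscM ω hω
        simp [hMe] at this
      rw [this, measureReal_empty]
      positivity
    · obtain ⟨h1, h2⟩ := (Finset.mem_filter.1 (M.max'_mem hMne)).2
      set m := M.max' hMne with hm
      have hch := measureReal_successes_le hX hsel k hw1 hwn (by linarith) hp1 hp hs1
        (m := m) (by linarith)
      refine (measureReal_mono ?_ (measure_ne_top _ _)).trans (hch.trans ?_)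
      · intro ω hω
        exact ⟨hω.1, M.le_max' _ (hscM ω hω)⟩
      · rw [← Real.exp_add]
        refine Real.exp_le_exp.2 ?_
        have := mul_le_mul_of_nonneg_left
          (klReal_add_two_mul_sq_le h1.le hy0 hyp.le hp1) hs0.le
        linarith
  calc _ ≤ μ.real (⋃ s ∈ Finset.Icc 1 n, A s) := measureReal_mono hsub (measure_ne_top _ _)
    _ ≤ ∑ s ∈ Finset.Icc 1 n, μ.real (A s) := measureReal_biUnion_finset_le _ _
    _ ≤ ∑ s ∈ Finset.Icc 1 n, Real.exp (-level τ c) * Real.exp (-(2 * ε ^ 2 * s)) :=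
        Finset.sum_le_sum hAP
    _ ≤ _ := by
        rw [← Finset.mul_sum]
        exact mul_le_mul_of_nonneg_left (mul_sum_exp_neg_le (by positivity) n) (Real.exp_pos _).le

/-! ### The regret -/

/-- The regret of a slot is at most `Δ` times the number of non-separated neighbors, unless it
exceeds `Δ`. -/
lemma slot_regret_le {K : ℕ} {r η : Fin K → ℝ} (hr : ∀ k, 0 < r k)
    (hη : ∀ k, η k ∈ Set.Icc (0 : ℝ) 1) (huni : IsUnimodal r η) {kst : Fin K}
    (hkst : ∀ k, r k * η k ≤ r kst * η kst) {Δ R : ℝ} (hΔ : 0 ≤ Δ) (hR : ∀ k, r k ≤ R)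
    (k : Fin K) :
    r kst * η kst - r k * η k ≤
      Δ * ((∑ k : Fin K, ((neighbors r η k).filter fun k' : Fin K =>
        |r k * η k - r k' * η k'| ≤ Δ).card : ℕ) : ℝ) +
      R * (if Δ < r kst * η kst - r k * η k then 1 else 0) := by
  generalize hH : (∑ k : Fin K, ((neighbors r η k).filter fun k' : Fin K =>
        |r k * η k - r k' * η k'| ≤ Δ).card) = H
  split_ifs with hgap
  · have h1 : 0 ≤ Δ * (H : ℝ) := mul_nonneg hΔ H.cast_nonneg
    have h2 : r kst * η kst ≤ R * 1 := mul_le_mul (hR _) (hη _).2 (hη _).1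
      ((hr kst).le.trans (hR _))
    have h3 : 0 ≤ r k * η k := mul_nonneg (hr _).le (hη _).1
    linarith
  rw [mul_zero, add_zero]
  push Not at hgap
  rcases le_or_gt (r kst * η kst - r k * η k) 0 with h0 | h0
  · exact h0.trans (mul_nonneg hΔ H.cast_nonneg)
  -- The neighbor is taken on the side of `kst`. The mode `m` of the unimodality may differ from
  -- `kst`, but lies on the same side of `k`, since `k` is strictly suboptimal.
  have key : ∃ k' : Fin K, ((k' : ℕ) + 1 = (k : ℕ) ∨ (k' : ℕ) = (k : ℕ) + 1) ∧
      r k * η k ≤ r k' * η k' := by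
    obtain ⟨m, hm1, hm2⟩ := huni
    have hne : k ≠ kst := by rintro rfl; linarith
    rcases lt_or_gt_of_ne hne with hlt | hlt
    · have hkm : k < m := by
        by_contra! h
        have := hm2 k kst h hlt.le
        linarith
      have hk1 : (k : ℕ) + 1 < K := by have := Fin.lt_def.1 hkm; omega
      refine ⟨⟨k + 1, hk1⟩, Or.inr rfl, hm1 _ _ ?_ ?_⟩
      · rw [Fin.le_def]; simp
      · rw [Fin.le_def]; exact hkm
    · have hkm : m < k := by
        by_contra! h
        have := hm1 kst k hlt.le h
        linarith
      have hk1 : 1 ≤ (k : ℕ) := by have := Fin.lt_def.1 hkm; omega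
      have hk2 : (k : ℕ) - 1 < K := by omega
      refine ⟨⟨k - 1, hk2⟩, Or.inl ?_, hm2 _ _ ?_ ?_⟩
      · simp only; omega
      · rw [Fin.le_def]; have := Fin.lt_def.1 hkm; simp only; omega
      · rw [Fin.le_def]; simp
  obtain ⟨k', hadj, hle⟩ := key
  have hH1 : 1 ≤ H := by
    rw [← hH]
    refine le_trans ?_ (Finset.single_le_sum (f := fun k => ((neighbors r η k).filter
      fun k' : Fin K => |r k * η k - r k' * η k'| ≤ Δ).card) (fun _ _ => Nat.zero_le _)
      (Finset.mem_univ k))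
    refine Finset.card_pos.2 ⟨k', ?_⟩
    simp only [neighbors, Finset.mem_filter, Finset.mem_univ, true_and]
    refine ⟨⟨hadj, hle.trans ?_⟩, ?_⟩
    · exact mul_le_of_le_one_right (hr _).le (hη _).2
    · rw [abs_le]
      have := hkst k'
      constructor <;> linarith
  have : (1 : ℝ) ≤ H := by exact_mod_cast hH1
  nlinarith

lemma sum_Ico_blocks (f : ℕ → ℝ) (τ J : ℕ) :
    ∑ n ∈ Finset.Ico 1 (1 + J * τ), f n =
      ∑ j ∈ Finset.range J, ∑ n ∈ Finset.Ico (1 + j * τ) (1 + j * τ + τ), f n := by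
  induction J with
  | zero => simp
  | succ J ih =>
    rw [Finset.sum_range_succ, ← ih, Finset.sum_Ico_consecutive _ (by omega) (by omega)]
    congr 2
    ring

open Classical in
/-- The slots with large regret are initial slots, slots in which the index of the optimal decision
is too low, or slots in which some other decision is visited. -/
lemma sum_ite_le_of_visits {K T τ J : ℕ} (hT : T ≤ J * τ) (B : ℕ → Prop) (U : ℕ → Prop)
    (P : Fin K → ℕ → Prop)
    (h : ∀ n, 1 ≤ n → n ≤ T → B n → n ≤ K ∨ U n ∨ ∃ k, P k n) :
    ∑ n ∈ Finset.Icc 1 T, (if B n then (1 : ℝ) else 0) ≤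
      K + ∑ n ∈ Finset.Icc 1 T, (if U n then (1 : ℝ) else 0) +
      ∑ k : Fin K, ∑ j ∈ Finset.range J,
        ((((Finset.Ico (1 + j * τ) (1 + j * τ + τ)).filter fun n => P k n).card : ℕ) : ℝ) := by
  have h1 : ∑ n ∈ Finset.Icc 1 T, (if n ≤ K then (1 : ℝ) else 0) ≤ K := by
    rw [Finset.sum_boole]
    have : ((Finset.Icc 1 T).filter fun n => n ≤ K) ⊆ Finset.Icc 1 K := by
      intro n hn
      simp only [Finset.mem_filter, Finset.mem_Icc] at hn ⊢
      omega
    exact_mod_cast (Finset.card_le_card this).trans (by simp)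
  have h2 : ∑ k : Fin K, ∑ n ∈ Finset.Icc 1 T, (if P k n then (1 : ℝ) else 0) ≤
      ∑ k : Fin K, ∑ j ∈ Finset.range J,
        ((((Finset.Ico (1 + j * τ) (1 + j * τ + τ)).filter fun n => P k n).card : ℕ) : ℝ) := by
    refine Finset.sum_le_sum fun k _ => ?_
    simp_rw [← Finset.sum_boole]
    rw [← sum_Ico_blocks]
    refine Finset.sum_le_sum_of_subset_of_nonneg ?_ fun n _ _ => by split_ifs <;> norm_num
    intro n hn
    simp only [Finset.mem_Icc, Finset.mem_Ico] at hn ⊢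
    omega
  refine le_trans ?_ (add_le_add (add_le_add h1 le_rfl) h2)
  rw [Finset.sum_comm, ← Finset.sum_add_distrib, ← Finset.sum_add_distrib]
  refine Finset.sum_le_sum fun n hn => ?_
  rw [Finset.mem_Icc] at hn
  have hP0 : 0 ≤ ∑ k : Fin K, (if P k n then (1 : ℝ) else 0) :=
    Finset.sum_nonneg fun k _ => by split_ifs <;> norm_num
  by_cases hB : B n
  · rw [if_pos hB]
    rcases h n hn.1 hn.2 hB with h' | h' | ⟨k, h'⟩
    · rw [if_pos h']
      split_ifs <;> linarith
    · rw [if_pos h']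
      split_ifs <;> linarith
    · have : (1 : ℝ) ≤ ∑ k : Fin K, (if P k n then (1 : ℝ) else 0) := by
        refine le_trans (le_of_eq (if_pos h').symm) (Finset.single_le_sum
          (f := fun k => if P k n then (1 : ℝ) else 0)
          (fun k _ => by split_ifs <;> norm_num) (Finset.mem_univ k))
      split_ifs <;> linarith
  · rw [if_neg hB]
    split_ifs <;> linarith

/-! ### The two regimes of g₀ -/

lemma le_of_gZero_eq_top {K : ℕ} {r : Fin K → ℝ} {θ : ℕ → Fin K → ℝ} {kstar : ℕ → Fin K} {σ : ℝ}
    {τ T : ℕ} (h : gZero r θ kstar σ τ T = ⊤) {n : ℕ} (hn : n ∈ Finset.Icc 1 T) {k : Fin K}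
    (hk : k ≠ kstar n) : r k ≤ r (kstar n) * (θ n (kstar n) - σ * τ) := by
  by_contra! hlt
  simp only [gZero, iInf_eq_top] at h
  exact EReal.coe_ne_top _ (h n hn k hk hlt)

/-- Since x(1 - x) ≤ 1/4, a finite g₀ is at most 1/8, and √8 ≥ 14/5. Nothing else about the value of
g₀ is needed. -/
lemma le_invSqrt_gZero {K : ℕ} {r : Fin K → ℝ} {θ : ℕ → Fin K → ℝ} {kstar : ℕ → Fin K} {σ : ℝ}
    {τ T : ℕ} (h : gZero r θ kstar σ τ T ≠ ⊤) (h0 : 0 < gZero r θ kstar σ τ T) :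
    14 / 5 ≤ invSqrt (gZero r θ kstar σ τ T) := by
  set g := gZero r θ kstar σ τ T with hg
  have hle : g ≤ ((1 / 8 : ℝ) : EReal) := by
    by_contra! hlt
    refine h ?_
    rw [hg]
    simp only [gZero, iInf_eq_top]
    intro n hn k hk hlt'
    exfalso
    have h1 : g ≤ ((1 / 2 * (ratio r θ kstar σ τ n k * (1 - ratio r θ kstar σ τ n k)) : ℝ) :
        EReal) := iInf_le_of_le n (iInf_le_of_le hn (iInf_le_of_le k (iInf_le_of_le hk
          (iInf_le _ hlt'))))
    have h2 := hlt.trans_le h1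
    rw [EReal.coe_lt_coe_iff] at h2
    nlinarith [sq_nonneg (ratio r θ kstar σ τ n k - 1 / 2)]
  have hcoe : ((g.toReal : ℝ) : EReal) = g := EReal.coe_toReal h (ne_bot_of_gt h0)
  have hg0 : 0 < g.toReal := by rw [← hcoe] at h0; exact_mod_cast h0
  have hg8 : g.toReal ≤ 1 / 8 := by rw [← hcoe] at hle; exact_mod_cast hle
  rw [invSqrt, if_neg h]
  refine le_trans ?_ (Real.rpow_le_rpow_of_nonpos hg0 hg8 (by norm_num))
  have : ((1 / 8 : ℝ)) ^ (-(1 / 2) : ℝ) = √8 := by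
    rw [Real.sqrt_eq_rpow, Real.rpow_neg (by norm_num), ← Real.inv_rpow (by norm_num)]
    norm_num
  rw [this]
  exact Real.le_sqrt_of_sq_le (by norm_num)

lemma invSqrt_nonneg {g : EReal} (h : 0 < g) : 0 ≤ invSqrt g := by
  unfold invSqrt
  split_ifs
  · exact le_rfl
  · exact Real.rpow_nonneg (EReal.toReal_nonneg h.le) _

/-- Gives τ e^{-L} ≤ 1, which pays for union bounds over τ slots. It needs log log τ ≥ 0, hence τ ≥
3. -/
lemma log_le_level {τ : ℕ} (hτ : 3 ≤ τ) {c : ℝ} (hc : 0 ≤ c) : Real.log τ ≤ level τ c := by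
  have h3 : (3 : ℝ) ≤ τ := by exact_mod_cast hτ
  have : 1 ≤ Real.log τ := by
    rw [Real.le_log_iff_exp_le (by linarith)]
    linarith [Real.exp_one_lt_d9]
  have := mul_nonneg hc (Real.log_nonneg this)
  unfold level
  linarith

open Classical in
/-- The expected number of slots in which the regret exceeds `Δ`, where `d` is the part of `Δ` that
remains after the drift of the throughputs within a window, relative to the largest rate `R`. -/
lemma meanLE_card_large_regret {Ω : Type*} {mΩ : MeasurableSpace Ω} {μ : Measure Ω}
    [IsProbabilityMeasure μ] {ℱ : Filtration ℕ mΩ} {K : ℕ} {r : Fin K → ℝ} (hr : ∀ k, 0 < r k)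
    {R : ℝ} (hR : ∀ k, r k ≤ R) (hK : 0 < K) {θ : ℕ → Fin K → ℝ} {σ : ℝ} (hσ : 0 < σ)
    (hθ : ∀ n, 1 ≤ n → ∀ k, θ n k ∈ Set.Icc (0 : ℝ) 1)
    (hlip : ∀ n n' : ℕ, 1 ≤ n → 1 ≤ n' → ∀ k, |θ n' k - θ n k| ≤ σ * |(n' : ℝ) - (n : ℝ)|)
    {kstar : ℕ → Fin K} {X : ℕ → Fin K → Ω → Bool} (hX : IsEnvironment μ ℱ θ X)
    {τ : ℕ} (hτ : 3 ≤ τ) {c : ℝ} (hτL : Real.log τ ≤ level τ c) {sel : ℕ → Ω → Fin K}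
    (hsel : ∀ n, 1 ≤ n → Measurable[ℱ (n - 1)] (sel n))
    (halg : ∀ ω, IsSWKLRUCB r τ c (fun t k => X t k ω) (fun n => sel n ω))
    {T : ℕ} (hT : τ ≤ T) {Δ d : ℝ} (hd0 : 0 < d) (hd1 : d ≤ 1) (hΔ : Δ = 2 * R * τ * σ + d * R)
    (hg : 0 < gZero r θ kstar σ τ T) :
    MeanLE μ (fun ω => ∑ n ∈ Finset.Icc 1 T,
        if Δ < r (kstar n) * θ n (kstar n) - r (sel n ω) * θ n (sel n ω) then (1 : ℝ) else 0)
      (T * (K * (1 + invSqrt (gZero r θ kstar σ τ T)) *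
        ((level τ c + (100000 + 4 * Real.exp 160)) / (2 * τ * d ^ 2)))) := by
  have hτ0 : (0 : ℝ) < τ := by exact_mod_cast (show 0 < τ by omega)
  have hL : 0 ≤ level τ c :=
    (Real.log_nonneg (by exact_mod_cast (show 1 ≤ τ by omega))).trans hτL
  have hRpos : 0 < R := (hr ⟨0, hK⟩).trans_le (hR _)
  set L := level τ c with hLdef
  set G := 1 + invSqrt (gZero r θ kstar σ τ T) with hG
  have hG1 : 1 ≤ G := by linarith [invSqrt_nonneg hg]
  set N := L / (2 * d ^ 2) with hNdef
  have hLN : L = 2 * d ^ 2 * N := by rw [hNdef]; field_simp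
  -- The margin below the optimal target, relative to `d * R`: small enough for both lemmas on
  -- visits, at the price of 1/η² = e^{160} in the constant.
  set η := Real.exp (-80) with hη
  have hη0 : 0 < η := Real.exp_pos _
  have hη1 : η ≤ 1 / 200 := by
    rw [hη, Real.exp_neg, ← one_div]
    exact one_div_le_one_div_of_le (by norm_num)
      (by linarith [Real.quadratic_le_exp_of_nonneg (show (0 : ℝ) ≤ 80 by norm_num)])
  have hηsq : 1 / η ^ 2 = Real.exp 160 := by
    rw [hη, ← Real.exp_nat_mul, one_div, ← Real.exp_neg]; norm_num
  have hdrift : ∀ n t : ℕ, 1 ≤ n → max 1 (n - τ) ≤ t → t < n → ∀ k,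
      |θ t k - θ n k| ≤ σ * τ := by
    intro n t hn ht htn k
    refine (hlip n t hn (by omega) k).trans (mul_le_mul_of_nonneg_left ?_ hσ.le)
    rw [abs_sub_comm, abs_of_nonneg (sub_nonneg.2 (by exact_mod_cast htn.le)), sub_le_iff_le_add]
    exact_mod_cast (show n ≤ τ + t by omega)
  -- the slots in which the index of the optimal decision is too low
  set U : ℕ → Set Ω := fun n => {ω | klIndex r τ c (fun t k => X t k ω) (fun t => sel t ω) n
    (kstar n) < r (kstar n) * (θ n (kstar n) - σ * τ - η * (d * R) / r (kstar n))} with hU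
  have hUP : ∀ n, 1 ≤ n → μ.real (U n) ≤ 1 / τ * (4 * Real.exp 160 / (2 * d ^ 2)) := by
    intro n hn
    have hrk := hr (kstar n)
    set δ := η * (d * R) / r (kstar n) with hδ
    have hδ1 : η * d ≤ δ := by
      rw [hδ, le_div_iff₀ hrk]
      nlinarith [mul_le_mul_of_nonneg_left (hR (kstar n)) (show 0 ≤ η * d by positivity)]
    have hδ0 : 0 < δ := lt_of_lt_of_le (by positivity) hδ1
    have hστ : 0 < σ * τ := by positivity
    refine (measureReal_klIndex_lt_le hX hsel hrk hL hn
      (y := θ n (kstar n) - σ * τ - δ) (p := θ n (kstar n) - σ * τ - δ / 2) (by linarith)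
      (by linarith [(hθ n hn (kstar n)).2]) ?_).trans ?_
    · intro t ht htn
      have := (abs_le.1 (hdrift n t hn ht htn (kstar n))).1
      linarith
    · have e1 : Real.exp (-L) ≤ 1 / τ := by
        rw [Real.exp_neg, ← one_div]
        exact one_div_le_one_div_of_le hτ0 ((Real.log_le_iff_le_exp hτ0).1 hτL)
      refine mul_le_mul e1 ?_ (by positivity) (by positivity)
      rw [← hηsq]
      have e2 : 4 * (1 / η ^ 2) / (2 * d ^ 2) = 1 / (2 * (η * d / 2) ^ 2) := by
        field_simp
        norm_num
      rw [e2]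
      refine one_div_le_one_div_of_le (by positivity) ?_
      refine mul_le_mul_of_nonneg_left (pow_le_pow_left₀ (by positivity) ?_ 2) (by norm_num)
      linarith
  -- the visits to suboptimal decisions
  set P : Fin K → ℕ → Ω → Prop := fun k n ω => K < n ∧ n ≤ T ∧ sel n ω = k ∧ ω ∉ U n ∧
    Δ < r (kstar n) * θ n (kstar n) - r k * θ n k with hP
  obtain ⟨ρ, ζ, B, u, hρ, hBu, hu0, hu10, hu, hζ, hρζ0, hρζ, huG, hvis⟩ :
      ∃ ρ ζ B u : ℝ, 1 / 2 ≤ ρ ∧ B ≤ u ∧ 0 ≤ u ∧ u ≤ 10 ∧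
        ζ + 101 / (400 * ρ) + 1 / 100 ≤ (ρ - 1 / 100) * u ∧ 0 ≤ ζ ∧ 0 ≤ ρ - ζ / 10 ∧
        1 ≤ 10 * (ρ - ζ / 10) ^ 2 ∧ 2 * u ≤ G ∧ ∀ k n ω, 1 ≤ n → P k n ω →
        (((pullSlots (fun t => sel t ω) k (max 1 (n - τ)) n).card : ℝ) ≤ B * N ∨
        d * (ρ * (pullSlots (fun t => sel t ω) k (max 1 (n - τ)) n).card - ζ * N) ≤
          excess θ (fun t k => X t k ω) (fun t => sel t ω) k (max 1 (n - τ)) n) := by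
    have hidx : ∀ k n ω, 1 ≤ n → P k n ω → r (kstar n) * (θ n (kstar n) - σ * τ) - η * (d * R) ≤
        klIndex r τ c (fun t k => X t k ω) (fun t => sel t ω) n k := by
      rintro k n ω hn ⟨hKn, hnT, hselk, hωU, hgap⟩
      have h1 : r (kstar n) * (θ n (kstar n) - σ * τ - η * (d * R) / r (kstar n)) ≤
        klIndex r τ c (fun t k => X t k ω) (fun t => sel t ω) n (kstar n) := not_lt.1 hωU
      have h2 := (halg ω).2 n hKn (kstar n)
      simp only [hselk] at h2
      refine le_trans (le_of_eq ?_) (h1.trans h2)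
      have := (hr (kstar n)).ne'
      field_simp
    have hmean : ∀ k n ω, 1 ≤ n → P k n ω → r k * (θ n k + σ * τ) + d * R ≤
        r (kstar n) * (θ n (kstar n) - σ * τ) := by
      rintro k n ω hn ⟨hKn, hnT, hselk, hωU, hgap⟩
      have hστ : 0 < σ * τ := by positivity
      have h1 := mul_le_mul_of_nonneg_right (hR k) hστ.le
      have h2 := mul_le_mul_of_nonneg_right (hR (kstar n)) hστ.le
      rw [hΔ] at hgap
      linarith
    have hup : ∀ k n t : ℕ, ∀ k : Fin K, 1 ≤ n → max 1 (n - τ) ≤ t → t < n →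
        θ t k ≤ θ n k + σ * τ := by
      intro _ n t k hn ht htn
      have := (abs_le.1 (hdrift n t hn ht htn k)).2
      linarith
    by_cases hgtop : gZero r θ kstar σ τ T = ⊤
    -- Here `G` may be 1, so u ≤ 1/2 is required.
    · refine ⟨9 / 10, 0, 1 / 3, 1 / 3, by norm_num, le_rfl, by norm_num, by norm_num, by norm_num,
        le_rfl, by norm_num, by norm_num, by linarith, fun k n ω hn hPn => ?_⟩
      refine excess_ge_of_rate_le (fun t => hup 0 n t k hn) ?_ (hr k) (hR k) hL hd0 hd1 hLN
        (hmean k n ω hn hPn) ?_ (hidx k n ω hn hPn)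
      · have := (hθ n hn k).1
        positivity
      · refine le_of_gZero_eq_top hgtop (Finset.mem_Icc.2 ⟨hn, hPn.2.1⟩) ?_
        rintro rfl
        have h1 := hPn.2.2.2.2
        rw [hΔ, sub_self] at h1
        have : 0 ≤ 2 * R * τ * σ + d * R := by positivity
        linarith
    · have hG2 := le_invSqrt_gZero hgtop hg
      -- Here G ≥ 19/5, while 2u = 88/25.
      refine ⟨33 / 50, 3 / 4, 0, 44 / 25, by norm_num, by norm_num, by norm_num, by norm_num,
        by norm_num, by norm_num, by norm_num, by norm_num, by linarith, fun k n ω hn hPn => ?_⟩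
      refine excess_ge_of_le_klIndex (R := R) (η := η) (fun t => hup 0 n t k hn) (hr k) (hR k) hL
        hd0 hLN hη1 ?_
      have h1 := hidx k n ω hn hPn
      have h2 := hmean k n ω hn hPn
      linarith
  have hPsel : ∀ k n ω, P k n ω → sel n ω = k := fun k n ω hPn => hPn.2.2.1
  have hPof : ∀ n ω, K < n → n ≤ T → ω ∉ U n →
      Δ < r (kstar n) * θ n (kstar n) - r (sel n ω) * θ n (sel n ω) → P (sel n ω) n ω :=
    fun n ω h1 h2 h3 h4 => ⟨h1, h2, rfl, h3, h4⟩
  clear_value P U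
  set J := T / τ + 1 with hJ
  have hTJ : T ≤ J * τ := by
    rw [hJ, mul_comm]
    exact (Nat.lt_mul_div_succ T (by omega)).le
  have hJ2 : (J : ℝ) ≤ 2 * (T / τ) := by
    have h1 : ((T / τ : ℕ) : ℝ) ≤ T / τ := Nat.cast_div_le
    have h2 : (1 : ℝ) ≤ T / τ := (one_le_div hτ0).2 (by exact_mod_cast hT)
    rw [hJ]
    push_cast
    linarith
  have hblock : ∀ k j, MeanLE μ (fun ω =>
      ((((Finset.Ico (1 + j * τ) (1 + j * τ + τ)).filter fun n => P k n ω).card : ℕ) : ℝ))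
      ((u * L + 26008) / (2 * d ^ 2)) := fun k j =>
    meanLE_card_visits hX hsel k (by omega) (by omega) hd0 hd1 hL hτL hNdef hρ hBu hu0 hu10 hu hζ
      hρζ0 hρζ (P k) fun n ω hn _ hPn => ⟨hPsel k n ω hPn, hvis k n ω (by omega) hPn⟩
  have htot := ((MeanLE.const (μ := μ) (K : ℝ)).add (MeanLE.sum (Finset.Icc 1 T) fun n hn =>
    MeanLE.of_measureReal_le (hUP n (Finset.mem_Icc.1 hn).1))).add
    (MeanLE.sum Finset.univ fun k _ => MeanLE.sum (Finset.range J) fun j _ => hblock k j)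
  refine htot.mono (fun ω => ?_) ?_
  · refine sum_ite_le_of_visits hTJ
      (fun n => Δ < r (kstar n) * θ n (kstar n) - r (sel n ω) * θ n (sel n ω)) (fun n => ω ∈ U n)
      (fun k n => P k n ω) fun n hn hnT hB => ?_
    by_cases h1 : n ≤ K
    · exact Or.inl h1
    by_cases h2 : ω ∈ U n
    · exact Or.inr (Or.inl h2)
    · exact Or.inr (Or.inr ⟨sel n ω, hPof n ω (by omega) hnT h2 hB⟩)
  · simp only [Finset.sum_const, Nat.card_Icc, Finset.card_univ, Fintype.card_fin,
      Finset.card_range, nsmul_eq_mul, Nat.add_sub_cancel]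
    have hK1 : (1 : ℝ) ≤ K := by exact_mod_cast hK
    have hTτ : (1 : ℝ) ≤ T / τ := (one_le_div hτ0).2 (by exact_mod_cast hT)
    have hdd : 1 ≤ 2 / (2 * d ^ 2) := by
      rw [le_div_iff₀ (by positivity)]
      nlinarith [pow_le_one₀ hd0.le hd1 (n := 2)]
    set S : ℝ := T / τ / (2 * d ^ 2) with hS
    have hS0 : 0 ≤ S := by positivity
    have hE := Real.exp_pos 160
    have t1 : (K : ℝ) ≤ K * (2 * S) := by
      refine le_mul_of_one_le_right (by linarith) ?_
      have : 2 * S = T / τ * (2 / (2 * d ^ 2)) := by rw [hS]; ring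
      rw [this]
      nlinarith
    have t2 : (T : ℝ) * (1 / τ * (4 * Real.exp 160 / (2 * d ^ 2))) ≤
        K * (4 * Real.exp 160 * S) := by
      have : (T : ℝ) * (1 / τ * (4 * Real.exp 160 / (2 * d ^ 2))) = 4 * Real.exp 160 * S := by
        rw [hS]; ring
      rw [this]
      exact le_mul_of_one_le_left (by positivity) hK1
    have t3 : (K : ℝ) * (J * ((u * L + 26008) / (2 * d ^ 2))) ≤
        K * ((2 * u * L + 52016) * S) := by
      refine mul_le_mul_of_nonneg_left ?_ (by linarith)
      have h0 : 0 ≤ (u * L + 26008) / (2 * d ^ 2) :=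
        div_nonneg (by linarith [mul_nonneg hu0 hL]) (by positivity)
      refine (mul_le_mul_of_nonneg_right hJ2 h0).trans (le_of_eq ?_)
      rw [hS]; ring
    have t4 : (T : ℝ) * (K * G * ((L + (100000 + 4 * Real.exp 160)) / (2 * τ * d ^ 2))) =
        K * (G * (L + (100000 + 4 * Real.exp 160)) * S) := by
      rw [hS]; field_simp
    rw [t4]
    refine (add_le_add (add_le_add t1 t2) t3).trans ?_
    rw [← mul_add, ← mul_add, ← add_mul, ← add_mul]
    refine mul_le_mul_of_nonneg_left (mul_le_mul_of_nonneg_right ?_ hS0) (by linarith)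
    have t5 := mul_le_mul_of_nonneg_right huG hL
    have t6 := mul_le_mul_of_nonneg_right hG1 (show 0 ≤ 100000 + 4 * Real.exp 160 by positivity)
    linarith

end RateBandit

/-! ### The regret bound -/

theorem mainTheorem12 :
    ∀ c : ℝ, 0 < c → ∃ C : ℝ, 0 < C ∧
      ∀ {Ω : Type*} [mΩ : MeasurableSpace Ω] (μ : MeasureTheory.Measure Ω)
        [MeasureTheory.IsProbabilityMeasure μ] (ℱ : MeasureTheory.Filtration ℕ mΩ)
        -- the rates
        (K : ℕ) (hK : 0 < K) (r : Fin K → ℝ) (_ : ∀ k, 0 < r k) (_ : StrictMono r)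
        -- the success probabilities: Lipschitz in time, unimodal throughputs
        (θ : ℕ → Fin K → ℝ) (σ : ℝ) (_ : 0 < σ)
        (_ : ∀ n, 1 ≤ n → ∀ k, θ n k ∈ Set.Icc (0 : ℝ) 1)
        (_ : ∀ n n' : ℕ, 1 ≤ n → 1 ≤ n' → ∀ k, |θ n' k - θ n k| ≤ σ * |(n' : ℝ) - (n : ℝ)|)
        (_ : ∀ n, 1 ≤ n → RateBandit.IsUnimodal r (θ n))
        -- an optimal decision at each time
        (kstar : ℕ → Fin K)
        (_ : ∀ n, 1 ≤ n → ∀ k, r k * θ n k ≤ r (kstar n) * θ n (kstar n))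
        -- the outcomes of the transmissions
        (X : ℕ → Fin K → Ω → Bool) (_ : RateBandit.IsEnvironment μ ℱ θ X)
        -- the window size, and the non-anticipating decisions of the algorithm
        (τ : ℕ) (_ : 2 ≤ τ) (_ : 0 ≤ RateBandit.level τ c)
        (sel : ℕ → Ω → Fin K) (_ : ∀ n, 1 ≤ n → Measurable[ℱ (n - 1)] (sel n))
        (_ : ∀ ω, RateBandit.IsSWKLRUCB r τ c (fun t k => X t k ω) (fun n => sel n ω))
        -- the time horizon and the separation
        (T : ℕ) (_ : τ ≤ T) (Δ : ℝ)
        (_ : 2 * r ⟨K - 1, Nat.sub_lt hK Nat.one_pos⟩ * τ * σ < Δ)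
        (_ : 0 < RateBandit.gZero r θ kstar σ τ T),
        RateBandit.regret μ r θ kstar sel T / T ≤
          Δ * RateBandit.nonSeparated r θ Δ T / T +
            K * r ⟨K - 1, Nat.sub_lt hK Nat.one_pos⟩ ^ 3 *
              (1 + RateBandit.invSqrt (RateBandit.gZero r θ kstar σ τ T)) *
              ((Real.log τ + c * Real.log (Real.log τ) + C) /
                (2 * τ * (Δ - 2 * r ⟨K - 1, Nat.sub_lt hK Nat.one_pos⟩ * τ * σ) ^ 2)) := by
  classical
  intro c hc
  refine ⟨100000 + 4 * Real.exp 160, by positivity, ?_⟩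
  intro Ω mΩ μ hμ ℱ K hK r hr hmono θ σ hσ hθ hlip huni kstar hkstar X hX τ hτ hL sel hsel halg T hT
    Δ hΔ hg
  set R := r ⟨K - 1, Nat.sub_lt hK Nat.one_pos⟩ with hRdef
  have hR : ∀ k, r k ≤ R := fun k => hmono.monotone (by rw [Fin.le_def]; simp only; omega)
  have hRpos : 0 < R := hr _
  have hτ0 : (0 : ℝ) < τ := by exact_mod_cast (show 0 < τ by omega)
  have hT0 : (0 : ℝ) < T := by exact_mod_cast (show 0 < T by omega)
  have hK1 : (1 : ℝ) ≤ K := by exact_mod_cast hK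
  have hG1 : 1 ≤ 1 + RateBandit.invSqrt (RateBandit.gZero r θ kstar σ τ T) := by
    linarith [RateBandit.invSqrt_nonneg hg]
  have hΔ0 : 0 ≤ Δ := by
    have : 0 ≤ 2 * R * τ * σ := by positivity
    linarith
  -- Normalizing by the largest rate accounts for the cube: R from the regret per slot, R² from
  -- 1/d².
  obtain ⟨d, hd⟩ : ∃ d, d = (Δ - 2 * R * τ * σ) / R := ⟨_, rfl⟩
  have hdR : Δ - 2 * R * τ * σ = d * R := by rw [hd]; field_simp
  have hd0 : 0 < d := by rw [hd]; exact div_pos (by linarith) hRpos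
  change RateBandit.regret μ r θ kstar sel T / T ≤ Δ * RateBandit.nonSeparated r θ Δ T / T +
    K * R ^ 3 * (1 + RateBandit.invSqrt (RateBandit.gZero r θ kstar σ τ T)) *
      ((RateBandit.level τ c + (100000 + 4 * Real.exp 160)) /
        (2 * τ * (Δ - 2 * R * τ * σ) ^ 2))
  set G := 1 + RateBandit.invSqrt (RateBandit.gZero r θ kstar σ τ T) with hG
  set L := RateBandit.level τ c with hLdef
  have hE := Real.exp_pos 160
  have hcount : RateBandit.MeanLE μ (fun ω => ∑ n ∈ Finset.Icc 1 T,
        if Δ < r (kstar n) * θ n (kstar n) - r (sel n ω) * θ n (sel n ω) then (1 : ℝ) else 0)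
      (T * (K * G * ((L + (100000 + 4 * Real.exp 160)) / (2 * τ * d ^ 2)))) := by
    rcases lt_or_ge 1 d with hd1 | hd1
    -- If d > 1 then Δ > R, and no slot has such a regret.
    · refine (RateBandit.MeanLE.const (0 : ℝ)).mono (fun ω => le_of_eq ?_) (by positivity)
      refine Finset.sum_eq_zero fun n hn => if_neg (not_lt.2 ?_)
      have hn1 := (Finset.mem_Icc.1 hn).1
      have h1 : r (kstar n) * θ n (kstar n) ≤ R * 1 :=
        mul_le_mul (hR _) (hθ n hn1 _).2 (hθ n hn1 _).1 hRpos.le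
      have h2 : 0 ≤ r (sel n ω) * θ n (sel n ω) := mul_nonneg (hr _).le (hθ n hn1 _).1
      have h3 : 0 ≤ 2 * R * τ * σ := by positivity
      nlinarith
    · rcases Nat.lt_or_ge τ 3 with hτ3 | hτ3
      · have hτ2 : (τ : ℝ) = 2 := by exact_mod_cast (show τ = 2 by omega)
        -- For τ = 2 the level may lie below log τ; the constant is so large that the trivial count
        -- `T` suffices.
        refine (RateBandit.MeanLE.const (T : ℝ)).mono (fun ω => ?_) ?_
        · rw [Finset.sum_boole]
          exact_mod_cast (Finset.card_filter_le _ _).trans (by simp)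
        · refine le_mul_of_one_le_right hT0.le ?_
          have h1 : 1 ≤ (K : ℝ) * G := one_le_mul_of_one_le_of_one_le hK1 hG1
          refine one_le_mul_of_one_le_of_one_le h1 ?_
          rw [hτ2, le_div_iff₀ (by positivity)]
          nlinarith [pow_le_one₀ hd0.le hd1 (n := 2)]
      · exact RateBandit.meanLE_card_large_regret hr hR hK hσ hθ hlip hX hτ3
          (RateBandit.log_le_level hτ3 hc.le) hsel halg hT hd0 hd1 (by linarith) hg
  have hregret : RateBandit.regret μ r θ kstar sel T ≤ Δ * RateBandit.nonSeparated r θ Δ T +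
      R * (T * (K * G * ((L + (100000 + 4 * Real.exp 160)) / (2 * τ * d ^ 2)))) := by
    refine (((RateBandit.MeanLE.const (Δ * RateBandit.nonSeparated r θ Δ T : ℝ)).add
      (hcount.const_mul hRpos.le)).mono (fun ω => ?_) le_rfl).integral_le ?_
    · rw [RateBandit.pathRegret, RateBandit.nonSeparated, Nat.cast_sum, Finset.mul_sum,
        Finset.mul_sum, ← Finset.sum_add_distrib]
      refine Finset.sum_le_sum fun n hn => ?_
      have hn1 := (Finset.mem_Icc.1 hn).1
      exact RateBandit.slot_regret_le hr (hθ n hn1) (huni n hn1) (hkstar n hn1) hΔ0 hR _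
    · unfold RateBandit.pathRegret
      refine MeasureTheory.integrable_finsetSum _ fun n hn => ?_
      have hn1 := (Finset.mem_Icc.1 hn).1
      refine (MeasureTheory.integrable_const _).sub ?_
      refine MeasureTheory.Integrable.of_bound (C := R) ?_ ?_
      · exact ((measurable_of_finite (fun k : Fin K => r k * θ n k)).comp
          ((hsel n hn1).mono (ℱ.le _) le_rfl)).aestronglyMeasurable
      · refine Filter.Eventually.of_forall fun ω => ?_
        have h2 : 0 ≤ r (sel n ω) * θ n (sel n ω) := mul_nonneg (hr _).le (hθ n hn1 _).1
        rw [Real.norm_of_nonneg h2]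
        exact (mul_le_of_le_one_right (hr _).le (hθ n hn1 _).2).trans (hR _)
  rw [hdR]
  rw [div_le_iff₀ hT0]
  refine hregret.trans (le_of_eq ?_)
  field_simp
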